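/- Let $H(\mathbb D)$ be the space of analytic functions on the open unit disk $\mathbb D$, and let $dA$ be the area measure normalized so that $A(\mathbb D)=1$. For $1<p<\infty$ let $B_p$ be the Besov space of all $f\in H(\mathbb D)$ with $$\|f\|_{B_p}=|f(0)|+\Big(\int_{\mathbb D}|f'(z)|^p(1-|z|^2)^{p-2}\,dA(z)\Big)^{1/p}<\infty;$$ let $\mathcal B$ be the Bloch space of all $f\in H(\mathbb D)$ with $|f(0)|+\sup_{z\in\mathbb D}(1-|z|^2)|f'(z)|<\infty$; and for $1<s<\infty$ let $\Lambda^s_{1/s}$ be the mean Lipschitz space of all $f\in H(\mathbb D)$ with $$|f(0)|+\sup_{0<r<1}(1-r)^{1-\frac1s}\Big(\frac1{2\pi}\int_0^{2\pi}|f'(re^{i\theta})|^s\,d\theta\Big)^{1/s}<\infty .$$ A Banach space of analytic functions in $\mathbb D$ is a complex linear subspace of $H(\mathbb D)$ with a complete norm for which all point evaluations $f\mapsto f(z)$, $z\in\mathbb D$, are continuous. For a finite positive Borel measure $\mu$ on $[0,1)$ with moments $\mu_n=\int_{[0,1)}t^n\,d\mu(t)$, and $f(z)=\sum_{n\ge0}a_nz^n$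 in $H(\mathbb D)$, put $$\mathcal C_\mu(f)(z)=\sum_{n=0}^\infty\Big(\mu_n\sum_{k=0}^na_k\Big)z^n,\qquad z\in\mathbb D .$$ **Theorem.** Suppose $1<p<\infty$, $1<s<\infty$, $X$ is a Banach space of analytic functions in $\mathbb D$ with $\Lambda^s_{1/s}\subseteq X\subseteq\mathcal B$, and $\mu$ is a finite positive Borel measure on $[0,1)$. Let $q$ be the real number satisfying $\frac1p+\frac1q=1$. Then the following conditions are equivalent: (i) $\mathcal C_\mu$ is a bounded operator from $B_p$ into $X$; (ii) $\mu$ is a $\frac1q$-logarithmic $1$-Carleson measure, that is, $$\sup_{t\in[0,1)}\frac{\mu([t,1))\big(\log\frac{e}{1-t}\big)^{1/q}}{1-t}<\infty .$$ -/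

import Mathlib

noncomputable section

open MeasureTheory Metric Set
open scoped ENNReal NNReal

/-- The space `H(𝔻)` of analytic functions on the open unit disk. Its elements are represented as
functions on `ℂ` that vanish outside the disk, so that two of them are equal exactly when they agree
on the disk. -/
def HolDisc : Submodule ℂ (ℂ → ℂ) where
  carrier := {f | DifferentiableOn ℂ f (ball 0 1) ∧ ∀ z ∉ ball (0 : ℂ) 1, f z = 0}
  zero_mem' := ⟨differentiableOn_const 0, fun _ _ => rfl⟩
  add_mem' := fun {f g} hf hg => ⟨hf.1.add hg.1, fun z hz => by
    simp [hf.2 z hz, hg.2 z hz]⟩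
  smul_mem' := fun c f hf => ⟨hf.1.const_smul c, fun z hz => by
    simp [hf.2 z hz]⟩

/-- The normalized area measure `dA` on the unit disk, `A(𝔻) = 1`. -/
def diskArea : Measure ℂ :=
  (ENNReal.ofReal Real.pi)⁻¹ • (volume.restrict (ball (0 : ℂ) 1))

/-- `‖f‖_{B_p} = |f(0)| + (∫_𝔻 |f'(z)|^p (1-|z|²)^{p-2} dA(z))^{1/p}`, with values in `[0,∞]`. -/
def besovNorm (p : ℝ) (f : HolDisc) : ℝ≥0∞ :=
  ‖f.1 0‖ₑ +
    (∫⁻ z, ‖deriv f.1 z‖ₑ ^ p * ENNReal.ofReal ((1 - ‖z‖ ^ 2) ^ (p - 2)) ∂diskArea) ^ (1 / p)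

/-- The Besov space `B_p`. -/
def Besov (p : ℝ) : Set HolDisc := {f | besovNorm p f < ∞}

/-- `‖f‖_𝓑 = |f(0)| + sup_{z ∈ 𝔻} (1-|z|²) |f'(z)|`, with values in `[0,∞]`. -/
def blochNorm (f : HolDisc) : ℝ≥0∞ :=
  ‖f.1 0‖ₑ + ⨆ z ∈ ball (0 : ℂ) 1, ENNReal.ofReal (1 - ‖z‖ ^ 2) * ‖deriv f.1 z‖ₑ

/-- The Bloch space `𝓑`. -/
def Bloch : Set HolDisc := {f | blochNorm f < ∞}

/-- The integral mean `M_s(r, g) = ((1/2π) ∫_0^{2π} |g(r e^{iθ})|^s dθ)^{1/s}`. -/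
def integralMean (s r : ℝ) (g : ℂ → ℂ) : ℝ≥0∞ :=
  ((ENNReal.ofReal (2 * Real.pi))⁻¹ *
    ∫⁻ θ in Ioc (0 : ℝ) (2 * Real.pi), ‖g (r * Complex.exp (θ * Complex.I))‖ₑ ^ s) ^ (1 / s)

/-- `‖f‖ = |f(0)| + sup_{0<r<1} (1-r)^{1-α} M_s(r, f')`, with values in `[0,∞]`. -/
def meanLipschitzNorm (s α : ℝ) (f : HolDisc) : ℝ≥0∞ :=
  ‖f.1 0‖ₑ +
    ⨆ r ∈ Ioo (0 : ℝ) 1, ENNReal.ofReal ((1 - r) ^ (1 - α)) * integralMean s r (deriv f.1)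

/-- The (analytic) mean Lipschitz space `Λ^s_α`. -/
def MeanLipschitz (s α : ℝ) : Set HolDisc := {f | meanLipschitzNorm s α f < ∞}

/-- The moment `μ_n = ∫_{[0,1)} t^n dμ(t)`. -/
def moment01 (μ : Measure (Ico (0 : ℝ) 1)) (n : ℕ) : ℝ := ∫ t, (t : ℝ) ^ n ∂μ

/-- The Taylor coefficient `a_n` of `f` at the origin. -/
def taylorCoeff (f : ℂ → ℂ) (n : ℕ) : ℂ := iteratedDeriv n f 0 / (n.factorial : ℂ)

/-- The coefficient `μ_n ∑_{k ≤ n} a_k`. -/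
def cesaroCoeff (μ : Measure (Ico (0 : ℝ) 1)) (f : ℂ → ℂ) (n : ℕ) : ℂ :=
  (moment01 μ n : ℂ) * ∑ k ∈ Finset.range (n + 1), taylorCoeff f k

lemma summable_taylorCoeff {f : ℂ → ℂ} (hf : DifferentiableOn ℂ f (ball 0 1)) {r : ℝ}
    (hr0 : 0 ≤ r) (hr1 : r < 1) : Summable fun n => ‖taylorCoeff f n‖ * r ^ n := by
  have h := Complex.hasSum_taylorSeries_on_ball (f := f) (c := 0) (r := 1) (z := (r : ℂ)) hf
    (by simpa [abs_of_nonneg hr0] using hr1)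
  have h2 := h.summable.norm
  refine h2.congr fun n => ?_
  simp [taylorCoeff, abs_of_nonneg hr0, div_eq_inv_mul]
  ring

lemma norm_moment01_le (μ : Measure (Ico (0 : ℝ) 1)) [IsFiniteMeasure μ] (n : ℕ) :
    ‖(moment01 μ n : ℂ)‖ ≤ μ.real univ := by
  rw [Complex.norm_real]
  have := norm_integral_le_of_norm_le_const (μ := μ) (f := fun t : Ico (0 : ℝ) 1 => (t : ℝ) ^ n)
    (C := 1) (Filter.Eventually.of_forall fun t => by
      rw [norm_pow, Real.norm_of_nonneg t.2.1]
      exact pow_le_one₀ t.2.1 t.2.2.le)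
  simpa [moment01] using this

lemma summable_cesaroCoeff (μ : Measure (Ico (0 : ℝ) 1)) [IsFiniteMeasure μ] {f : ℂ → ℂ}
    (hf : DifferentiableOn ℂ f (ball 0 1)) {r : ℝ} (hr0 : 0 ≤ r) (hr1 : r < 1) :
    Summable fun n => ‖cesaroCoeff μ f n‖ * r ^ n := by
  have h1 := summable_taylorCoeff hf hr0 hr1
  have h2 := summable_geometric_of_lt_one hr0 hr1
  have h3 := (summable_norm_sum_mul_range_of_summable_norm (R := ℝ) h1.norm h2.norm).mul_left
    (μ.real univ)
  refine Summable.of_nonneg_of_le (fun n => by positivity) (fun n => ?_) h3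
  rw [cesaroCoeff, norm_mul, mul_assoc]
  refine mul_le_mul (norm_moment01_le μ n) ?_ (by positivity) measureReal_nonneg
  refine le_trans ?_ (le_abs_self _)
  refine (mul_le_mul_of_nonneg_right (norm_sum_le _ _) (by positivity)).trans ?_
  rw [Finset.sum_mul]
  refine Finset.sum_le_sum fun k hk => le_of_eq ?_
  rw [mul_assoc, ← pow_add, Nat.add_sub_cancel' (Nat.lt_succ_iff.mp (Finset.mem_range.mp hk))]

/-- The Cesàro-like operator
`C_μ(f)(z) = ∑_{n ≥ 0} (μ_n ∑_{k ≤ n} a_k) z^n`, `z ∈ 𝔻`, on `H(𝔻)`. -/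
def cesaroLike (μ : Measure (Ico (0 : ℝ) 1)) [IsFiniteMeasure μ] (f : HolDisc) : HolDisc :=
  ⟨(ball (0 : ℂ) 1).indicator fun z => ∑' n, cesaroCoeff μ f.1 n * z ^ n, by
    refine ⟨?_, fun z hz => indicator_of_notMem hz _⟩
    have key : DifferentiableOn ℂ (fun z => ∑' n, cesaroCoeff μ f.1 n * z ^ n) (ball 0 1) := by
      intro z hz
      obtain ⟨r, hzr, hr1⟩ := exists_between (mem_ball_zero_iff.mp hz)
      have hr0 : 0 ≤ r := (norm_nonneg z).trans hzr.le
      have hd : DifferentiableOn ℂ (fun z => ∑' n, cesaroCoeff μ f.1 n * z ^ n) (ball 0 r) := by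
        refine Complex.differentiableOn_tsum_of_summable_norm
          (summable_cesaroCoeff μ f.2.1 hr0 hr1)
          (fun n => by fun_prop) isOpen_ball fun n w hw => ?_
        rw [norm_mul, norm_pow]
        have := (mem_ball_zero_iff.mp hw).le
        gcongr
      exact (hd.differentiableAt (isOpen_ball.mem_nhds (by simpa using hzr))).differentiableWithinAt
    exact key.congr fun z hz => indicator_of_mem hz _⟩

/-- `μ` is an `α`-logarithmic `s`-Carleson measure on `[0,1)`:
`sup_{t ∈ [0,1)} μ([t,1)) (log (e/(1-t)))^α / (1-t)^s < ∞`. -/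
def IsLogCarleson (α s : ℝ) (μ : Measure (Ico (0 : ℝ) 1)) : Prop :=
  BddAbove (range fun t : Ico (0 : ℝ) 1 =>
    μ.real (Ici t) * (Real.log (Real.exp 1 / (1 - (t : ℝ)))) ^ α / (1 - (t : ℝ)) ^ s)

/-- A Banach space of analytic functions on the disk: a complex Banach space `X`, realized through
the injective linear map `ι` as a linear subspace of `H(𝔻)`, on which all point evaluations are
continuous. -/
structure IsAnalyticBanachSpace {X : Type*} [NormedAddCommGroup X] [NormedSpace ℂ X]
    (ι : X →ₗ[ℂ] HolDisc) : Prop where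
  complete : CompleteSpace X
  injective : Function.Injective ι
  continuous_eval : ∀ z ∈ ball (0 : ℂ) 1, Continuous fun x : X => (ι x).1 z

/-- The (linear) operator `T` on `H(𝔻)` is bounded from `B_p` into the space `X`. -/
def IsBoundedFromBesov (p : ℝ) {X : Type*} [NormedAddCommGroup X] [NormedSpace ℂ X]
    (ι : X →ₗ[ℂ] HolDisc) (T : HolDisc → HolDisc) : Prop :=
  ∃ C : ℝ≥0, ∀ f ∈ Besov p, ∃ x : X, ι x = T f ∧ ‖x‖ₑ ≤ C * besovNorm p f

end

section

open MeasureTheory Metric Set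
open scoped ENNReal NNReal

/-! Everything rests on the formula `C_μ f(z) = ∫ f(tz)/(1-tz) dμ(t)` (`cesaroLike_eq_integral`),
which turns the derivative of `C_μ f` into an integral of `f'(w)/(1-w) + f(w)/(1-w)²` at `w = tz`.

Sufficiency. In `B_p` one has `|f'(w)| ≲ ‖f‖/(1-|w|)` and `|f(w)| ≲ ‖f‖ (log (e/(1-|w|)))^{1/q}`;
the exponent `1/q` comes from Hölder's inequality along a radius (`norm_le_of_besov`). Fix `1/s < a
< 1` and split `|1-w|⁻¹` as `|1-w|^{-a} |1-w|^{a-1}`. The first factor is controlled by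
`|1-z|^{-a}`, the second by `(1-|w|)^{a-1}`, and the Carleson condition integrates the remaining
logarithmic weight (`integral_logWeight_le`). Hence `|(C_μ f)'(z)| ≲ ‖f‖ |1-z|^{-a} (1-|z|)^{a-1}`
(`norm_deriv_cesaroLike_le`), and since `as > 1` this bound forces membership in `Λ^s_{1/s}`, so in
`X`.

Necessity. The functions `c - log(1-az)` have `B_p` norm at most a constant times `L^{1/p}`, where
`L = log (e/(1-a))`, while the derivative of their image at `z = a` is at least a constant times
`μ([a,1)) L/(1-a)²`. The Bloch bound on that derivative gives `μ([a,1)) L^{1-1/p} ≲ 1-a`.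

The hypotheses on `X` are inclusions of sets only. The norm estimates they entail come from the
closed graph theorem (`exists_norm_le_of_dominated`) and from uniform boundedness
(`exists_norm_deriv_le_of_range_subset_bloch`). -/

/-! ### Sub-mean value inequalities -/

/-- Polar coordinates centred at `c` on a disc. -/
lemma lintegral_ball_eq_polar (c : ℂ) (R : ℝ) {u : ℂ → ℝ≥0∞} (hu : Measurable u) :
    ∫⁻ z in ball c R, u z = ∫⁻ r in Ioo (0 : ℝ) R, ENNReal.ofReal r *
      ∫⁻ θ in Ioo (-Real.pi) Real.pi, u (c + r * Complex.exp (θ * Complex.I)) := by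
  have h1 : ∫⁻ z in ball c R, u z = ∫⁻ w, (ball (0 : ℂ) R).indicator (fun w => u (c + w)) w := by
    rw [← lintegral_indicator measurableSet_ball, ← lintegral_add_left_eq_self _ c]
    refine lintegral_congr fun w => ?_
    simp [indicator]
  have hm : Measurable fun p : ℝ × ℝ =>
      ENNReal.ofReal p.1 • (ball (0 : ℂ) R).indicator (fun w => u (c + w))
        (Complex.polarCoord.symm p) := by
    refine (by fun_prop : Measurable fun p : ℝ × ℝ => ENNReal.ofReal p.1).mul ?_
    refine ((hu.comp (measurable_const_add c)).indicator measurableSet_ball).comp ?_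
    rw [show (Complex.polarCoord.symm : ℝ × ℝ → ℂ) = fun p =>
      (p.1 : ℂ) * (Real.cos p.2 + Real.sin p.2 * Complex.I) from
      funext Complex.polarCoord_symm_apply]
    fun_prop
  rw [h1, ← Complex.lintegral_comp_polarCoord_symm, polarCoord_target,
    Measure.volume_eq_prod, setLIntegral_prod _ hm.aemeasurable,
    ← lintegral_indicator measurableSet_Ioi, ← lintegral_indicator measurableSet_Ioo]
  refine lintegral_congr fun r => ?_
  have hz : ∀ θ : ℝ, Complex.polarCoord.symm (r, θ) = r * Complex.exp (θ * Complex.I) := by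
    intro θ
    rw [Complex.polarCoord_symm_apply, Complex.exp_mul_I]
    push_cast; rfl
  by_cases hr : 0 < r
  · by_cases hR : r < R
    · rw [indicator_of_mem (mem_Ioi.2 hr), indicator_of_mem (mem_Ioo.2 ⟨hr, hR⟩),
        ← lintegral_const_mul' _ _ ENNReal.ofReal_ne_top]
      refine lintegral_congr fun θ => ?_
      rw [hz, indicator_of_mem]
      · rfl
      · simpa [Complex.norm_exp_ofReal_mul_I, abs_of_pos hr] using hR
    · rw [indicator_of_mem (mem_Ioi.2 hr), indicator_of_notMem (fun h => hR h.2)]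
      refine (lintegral_congr fun θ => ?_).trans lintegral_zero
      rw [hz, indicator_of_notMem, smul_zero]
      simpa [Complex.norm_exp_ofReal_mul_I, abs_of_pos hr] using hR
  · rw [indicator_of_notMem (show r ∉ Ioi 0 from hr),
      indicator_of_notMem (show r ∉ Ioo 0 R from fun h => hr h.1)]

/-- The mean value property bounds `|g(c)|` by an `L¹` mean over the circle, and Hölder's inequality
passes from `L¹` to `L^p`. -/
lemma enorm_rpow_le_lintegral_circle {g : ℂ → ℂ} {c : ℂ} {R p : ℝ} (hp : 1 ≤ p)
    (hg : DifferentiableOn ℂ g (ball c R)) (hgm : Measurable g) {r : ℝ} (hr : 0 < r) (hrR : r < R) :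
    ENNReal.ofReal (2 * Real.pi) * ‖g c‖ₑ ^ p ≤
      ∫⁻ θ in Ioo (-Real.pi) Real.pi, ‖g (c + r * Complex.exp (θ * Complex.I))‖ₑ ^ p := by
  have hp0 : 0 < p := by linarith
  have hsub : closedBall c r ⊆ ball c R := closedBall_subset_ball hrR
  have hd : DiffContOnCl ℂ g (ball c |r|) := by
    rw [abs_of_pos hr]
    exact (hg.mono hsub).diffContOnCl_ball subset_rfl
  have hav := hd.circleAverage
  rw [Real.circleAverage_eq_integral_add (-Real.pi), intervalIntegral.integral_comp_add_right
    (fun θ => g (circleMap c r θ)), zero_add, show 2 * Real.pi + -Real.pi = Real.pi by ring,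
    inv_smul_eq_iff₀ (by positivity), intervalIntegral.integral_of_le (by linarith [Real.pi_pos]),
    integral_Ioc_eq_integral_Ioo] at hav
  set ν := (volume : Measure ℝ).restrict (Ioo (-Real.pi) Real.pi) with hν
  have hνu : ν univ = ENNReal.ofReal (2 * Real.pi) := by
    rw [hν, Measure.restrict_apply_univ, Real.volume_Ioo]
    congr 1; ring
  set G : ℝ → ℂ := fun θ => g (circleMap c r θ) with hG
  have hGm : AEStronglyMeasurable G ν :=
    (hgm.comp (continuous_circleMap c r).measurable).aestronglyMeasurable
  have h1 : ENNReal.ofReal (2 * Real.pi) * ‖g c‖ₑ ≤ eLpNorm' G 1 ν := by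
    have : ENNReal.ofReal (2 * Real.pi) * ‖g c‖ₑ = ‖∫ θ, G θ ∂ν‖ₑ := by
      rw [hav, enorm_smul, Real.enorm_of_nonneg (by positivity)]
    rw [this, eLpNorm'_eq_lintegral_enorm]
    simpa using enorm_integral_le_lintegral_enorm G
  have h2 := h1.trans (eLpNorm'_le_eLpNorm'_mul_rpow_measure_univ one_pos hp hGm)
  have h3 := ENNReal.rpow_le_rpow h2 hp0.le
  set I := ∫⁻ θ, ‖G θ‖ₑ ^ p ∂ν with hI
  have h4 : eLpNorm' G p ν = I ^ (1 / p) := rfl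
  set m := ENNReal.ofReal (2 * Real.pi) with hm
  have hm0 : m ≠ 0 := by simp [hm, Real.pi_pos]
  have hmt : m ≠ ∞ := ENNReal.ofReal_ne_top
  rw [h4, hνu, ENNReal.mul_rpow_of_nonneg _ _ hp0.le, ENNReal.mul_rpow_of_nonneg _ _ hp0.le,
    ← ENNReal.rpow_mul, ← ENNReal.rpow_mul, one_div_mul_cancel hp0.ne', ENNReal.rpow_one,
    show (1 / 1 - 1 / p) * p = p - 1 by field_simp, show m ^ p = m ^ (p - 1) * m by
      conv_rhs => rw [← ENNReal.rpow_one m, ← ENNReal.rpow_mul, one_mul,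
        ← ENNReal.rpow_add _ _ hm0 hmt, sub_add_cancel], mul_assoc, mul_comm I] at h3
  have h5 : m ^ (p - 1) ≠ 0 := by
    simp [hm0, hmt]
  have h6 : m ^ (p - 1) ≠ ∞ := by
    simp [hm0, hmt]
  exact (ENNReal.mul_le_mul_iff_right h5 h6).1 h3

lemma enorm_rpow_le_lintegral_ball {g : ℂ → ℂ} {c : ℂ} {R p : ℝ} (hp : 1 ≤ p)
    (hg : DifferentiableOn ℂ g (ball c R)) (hgm : Measurable g) (hR : 0 < R) :
    ENNReal.ofReal (Real.pi * R ^ 2) * ‖g c‖ₑ ^ p ≤ ∫⁻ z in ball c R, ‖g z‖ₑ ^ p := by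
  have h1 : volume (ball c R) = ENNReal.ofReal (Real.pi * R ^ 2) := by
    rw [Complex.volume_ball, ENNReal.ofReal_mul Real.pi_pos.le, mul_comm,
      ENNReal.ofReal_pow hR.le, ENNReal.ofReal_eq_coe_nnreal Real.pi_pos.le]
    rfl
  rw [← h1, mul_comm, ← setLIntegral_const, lintegral_ball_eq_polar c R measurable_const,
    lintegral_ball_eq_polar c R (hgm.enorm.pow_const p)]
  refine setLIntegral_mono' measurableSet_Ioo fun r hr => ?_
  refine mul_le_mul_right ?_ _
  refine le_trans (le_of_eq ?_) (enorm_rpow_le_lintegral_circle hp hg hgm hr.1 hr.2)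
  rw [setLIntegral_const, Real.volume_Ioo, mul_comm]
  congr 2; ring

/-- Comparability in both directions makes the sign of the exponent irrelevant. The factor 4
suffices for `1-|w|²` against `1-|z|` when `|w-z| < (1-|z|)/2`. -/
lemma Real.rpow_le_four_rpow_abs_mul {u v : ℝ} (α : ℝ) (hu : 0 < u) (hv : 0 < v) (h1 : v ≤ 4 * u)
    (h2 : u ≤ 4 * v) : v ^ α ≤ 4 ^ |α| * u ^ α := by
  rcases le_total 0 α with h | h
  · rw [abs_of_nonneg h, ← Real.mul_rpow (by norm_num) hu.le]
    exact Real.rpow_le_rpow hv.le h1 h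
  · rw [abs_of_nonpos h, Real.rpow_neg (by norm_num), ← Real.inv_rpow (by norm_num),
      ← Real.mul_rpow (by norm_num) hu.le]
    exact Real.rpow_le_rpow_of_nonpos (by positivity) (by linarith) h

lemma holDisc_differentiableOn_deriv (f : HolDisc) :
    DifferentiableOn ℂ (deriv f.1) (ball 0 1) := f.2.1.deriv isOpen_ball

lemma holDisc_differentiableAt (f : HolDisc) {z : ℂ} (hz : ‖z‖ < 1) : DifferentiableAt ℂ f.1 z :=
  f.2.1.differentiableAt (isOpen_ball.mem_nhds (by simpa using hz))

lemma lintegral_deriv_le_besovNorm {p : ℝ} (hp : 0 < p) (f : HolDisc) :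
    ∫⁻ z in ball (0 : ℂ) 1, ‖deriv f.1 z‖ₑ ^ p * ENNReal.ofReal ((1 - ‖z‖ ^ 2) ^ (p - 2)) ≤
      ENNReal.ofReal Real.pi * besovNorm p f ^ p := by
  set J := ∫⁻ z in ball (0 : ℂ) 1, ‖deriv f.1 z‖ₑ ^ p * ENNReal.ofReal ((1 - ‖z‖ ^ 2) ^ (p - 2))
    with hJ
  have h0 : ENNReal.ofReal Real.pi ≠ 0 := by simp [Real.pi_pos]
  have h1 : ((ENNReal.ofReal Real.pi)⁻¹ * J) ^ (1 / p) ≤ besovNorm p f := by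
    rw [besovNorm, diskArea, lintegral_smul_measure]
    exact le_add_self
  have h2 := ENNReal.rpow_le_rpow h1 hp.le
  rw [← ENNReal.rpow_mul, one_div_mul_cancel hp.ne', ENNReal.rpow_one] at h2
  calc J = ENNReal.ofReal Real.pi * ((ENNReal.ofReal Real.pi)⁻¹ * J) := by
        rw [← mul_assoc, ENNReal.mul_inv_cancel h0 ENNReal.ofReal_ne_top, one_mul]
    _ ≤ _ := by gcongr

/-- A weighted sub-mean value property on hyperbolic discs. -/
lemma enorm_rpow_mul_le_lintegral_ball {g : ℂ → ℂ} {p : ℝ} (hp : 1 ≤ p) (β : ℝ)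
    (hg : DifferentiableOn ℂ g (ball 0 1)) (hgm : Measurable g) {z : ℂ} (hz : ‖z‖ < 1) :
    ‖g z‖ₑ ^ p * ENNReal.ofReal ((1 - ‖z‖) ^ (β + 2)) ≤
      ENNReal.ofReal (4 ^ (|β| + 1) / Real.pi) * ∫⁻ w in ball z ((1 - ‖z‖) / 2),
        ‖g w‖ₑ ^ p * ENNReal.ofReal ((1 - ‖w‖ ^ 2) ^ β) := by
  have hδ : 0 < 1 - ‖z‖ := by linarith
  have hsub : ball z ((1 - ‖z‖) / 2) ⊆ ball 0 1 := by
    refine ball_subset_ball' ?_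
    rw [dist_zero_right]; linarith
  have h1 := enorm_rpow_le_lintegral_ball hp (hg.mono hsub) hgm (half_pos hδ)
  have h2 : ENNReal.ofReal ((1 - ‖z‖) ^ β) * ∫⁻ w in ball z ((1 - ‖z‖) / 2), ‖g w‖ₑ ^ p ≤
      ENNReal.ofReal (4 ^ |β|) * ∫⁻ w in ball z ((1 - ‖z‖) / 2),
        ‖g w‖ₑ ^ p * ENNReal.ofReal ((1 - ‖w‖ ^ 2) ^ β) := by
    rw [← lintegral_const_mul' _ _ ENNReal.ofReal_ne_top,
      ← lintegral_const_mul' _ _ ENNReal.ofReal_ne_top]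
    refine setLIntegral_mono' measurableSet_ball fun w hw => ?_
    rw [mem_ball, dist_eq_norm] at hw
    have a1 := norm_sub_norm_le w z
    have a2 := norm_sub_norm_le z w
    rw [norm_sub_rev] at a2
    have a3 := norm_nonneg w
    have a4 := norm_nonneg z
    rw [mul_left_comm, mul_comm, ← ENNReal.ofReal_mul (by positivity)]
    gcongr
    exact Real.rpow_le_four_rpow_abs_mul β (by nlinarith) hδ (by nlinarith) (by nlinarith)
  calc ‖g z‖ₑ ^ p * ENNReal.ofReal ((1 - ‖z‖) ^ (β + 2))
      = ENNReal.ofReal (4 / Real.pi) * (ENNReal.ofReal ((1 - ‖z‖) ^ β) *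
        (ENNReal.ofReal (Real.pi * ((1 - ‖z‖) / 2) ^ 2) * ‖g z‖ₑ ^ p)) := by
        rw [← mul_assoc, ← mul_assoc, ← ENNReal.ofReal_mul (by positivity),
          ← ENNReal.ofReal_mul (by positivity), mul_comm, Real.rpow_add hδ, Real.rpow_two]
        congr 2
        field_simp
        ring
    _ ≤ ENNReal.ofReal (4 / Real.pi) * (ENNReal.ofReal (4 ^ |β|) *
        ∫⁻ w in ball z ((1 - ‖z‖) / 2), ‖g w‖ₑ ^ p * ENNReal.ofReal ((1 - ‖w‖ ^ 2) ^ β)) := by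
        gcongr ENNReal.ofReal (4 / Real.pi) * ?_
        refine le_trans ?_ h2
        gcongr
    _ = _ := by
        rw [← mul_assoc, ← ENNReal.ofReal_mul (by positivity), Real.rpow_add (by norm_num),
          Real.rpow_one]
        congr 2
        ring

/-! ### Growth of Besov functions and of their derivatives -/

/-- With `β = p-2` the weighted sub-mean value property has the Besov integrand on its right and
`(|f'(z)| (1-|z|))^p` on its left. -/
lemma norm_deriv_le_of_besov {p : ℝ} (hp : 1 < p) : ∃ C : ℝ, 0 ≤ C ∧ ∀ f ∈ Besov p, ∀ z : ℂ,
    ‖z‖ < 1 → ‖deriv f.1 z‖ ≤ C * (besovNorm p f).toReal / (1 - ‖z‖) := by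
  have hp0 : 0 < p := by linarith
  refine ⟨(4 ^ (|p - 2| + 1)) ^ (1 / p), by positivity, fun f hf z hz => ?_⟩
  have hδ : 0 < 1 - ‖z‖ := by linarith
  have h1 := enorm_rpow_mul_le_lintegral_ball hp.le (p - 2) (holDisc_differentiableOn_deriv f)
    (measurable_deriv f.1) hz
  have hsub : ball z ((1 - ‖z‖) / 2) ⊆ ball 0 1 := by
    refine ball_subset_ball' ?_
    rw [dist_zero_right]; linarith
  have h2 := h1.trans (mul_le_mul_right ((lintegral_mono_set hsub).trans
    (lintegral_deriv_le_besovNorm hp0 f)) _)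
  have hN : besovNorm p f = ENNReal.ofReal (besovNorm p f).toReal :=
    (ENNReal.ofReal_toReal (ne_of_lt hf)).symm
  set N := (besovNorm p f).toReal with hN'
  have hN0 : 0 ≤ N := ENNReal.toReal_nonneg
  rw [hN, ← ofReal_norm, ENNReal.ofReal_rpow_of_nonneg hN0 hp0.le,
    ENNReal.ofReal_rpow_of_nonneg (norm_nonneg _) hp0.le, ← ENNReal.ofReal_mul (by positivity),
    ← ENNReal.ofReal_mul (by positivity), ← ENNReal.ofReal_mul (by positivity),
    ENNReal.ofReal_le_ofReal_iff (by positivity), sub_add_cancel,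
    ← Real.mul_rpow (norm_nonneg _) hδ.le, ← mul_assoc, div_mul_cancel₀ _ Real.pi_ne_zero] at h2
  rw [le_div_iff₀ hδ, ← Real.rpow_le_rpow_iff (by positivity) (by positivity) hp0,
    Real.mul_rpow (by positivity) hN0, ← Real.rpow_mul (by positivity), one_div_mul_cancel hp0.ne',
    Real.rpow_one]
  exact h2

/-- A Carleson embedding for a radius. The sub-mean value property is applied at each point of the
radius with weight exponent `p-3`. After Tonelli, a point `w` is charged only by a set of `x` of
length at most `2(1-|w|)`, which raises the exponent to `p-2`. -/
lemma lintegral_ray_le {g : ℂ → ℂ} {p : ℝ} (hp : 1 ≤ p)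
    (hg : DifferentiableOn ℂ g (ball 0 1)) (hgm : Measurable g) {ζ : ℂ} (hζ : ‖ζ‖ = 1) :
    ∫⁻ x in Ioo (0 : ℝ) 1, ‖g (x * ζ)‖ₑ ^ p * ENNReal.ofReal ((1 - x) ^ (p - 1)) ≤
      ENNReal.ofReal (2 * 4 ^ (|p - 3| + 1) / Real.pi) *
        ∫⁻ w in ball (0 : ℂ) 1, ‖g w‖ₑ ^ p * ENNReal.ofReal ((1 - ‖w‖ ^ 2) ^ (p - 2)) := by
  set F : ℂ → ℝ≥0∞ := fun w => ‖g w‖ₑ ^ p * ENNReal.ofReal ((1 - ‖w‖ ^ 2) ^ (p - 3)) with hF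
  have hFm : Measurable F := by
    refine (hgm.enorm.pow_const p).mul ?_
    fun_prop
  have hxn : ∀ x ∈ Ioo (0 : ℝ) 1, ‖(x : ℂ) * ζ‖ = x := fun x hx => by
    simp [hζ, abs_of_pos hx.1]
  set S : Set (ℝ × ℂ) := {q | ‖q.2 - q.1 * ζ‖ < (1 - q.1) / 2} with hS
  have hSm : MeasurableSet S := by
    refine measurableSet_lt ?_ ?_ <;> fun_prop
  have hmeas : Measurable fun q : ℝ × ℂ => S.indicator (fun q => F q.2) q :=
    (hFm.comp measurable_snd).indicator hSm
  have h1 : ∫⁻ x in Ioo (0 : ℝ) 1, ‖g (x * ζ)‖ₑ ^ p * ENNReal.ofReal ((1 - x) ^ (p - 1)) ≤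
      ∫⁻ x in Ioo (0 : ℝ) 1, ENNReal.ofReal (4 ^ (|p - 3| + 1) / Real.pi) *
        ∫⁻ w in ball (0 : ℂ) 1, S.indicator (fun q => F q.2) (x, w) := by
    refine setLIntegral_mono' measurableSet_Ioo fun x hx => ?_
    have h := enorm_rpow_mul_le_lintegral_ball hp (p - 3) hg hgm
      (z := x * ζ) (by rw [hxn x hx]; exact hx.2)
    rw [hxn x hx, show p - 3 + 2 = p - 1 by ring] at h
    refine h.trans (mul_le_mul_right ?_ _)
    rw [← lintegral_indicator measurableSet_ball, ← lintegral_indicator measurableSet_ball]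
    refine lintegral_mono fun w => ?_
    by_cases hw : w ∈ ball ((x : ℂ) * ζ) ((1 - x) / 2)
    · have hw' : (x, w) ∈ S := by simpa [hS, dist_eq_norm] using hw
      have hw1 : w ∈ ball (0 : ℂ) 1 := by
        refine ball_subset_ball' ?_ hw
        rw [dist_zero_right, hxn x hx]; linarith [hx.2]
      rw [indicator_of_mem hw, indicator_of_mem hw1, indicator_of_mem hw']
    · rw [indicator_of_notMem hw]; exact zero_le
  refine h1.trans ?_
  rw [lintegral_const_mul' _ _ ENNReal.ofReal_ne_top,
    lintegral_lintegral_swap hmeas.aemeasurable, mul_comm (2 : ℝ), mul_div_right_comm,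
    ENNReal.ofReal_mul (by positivity), mul_assoc]
  refine mul_le_mul_right ?_ _
  rw [← lintegral_const_mul' _ _ ENNReal.ofReal_ne_top]
  refine setLIntegral_mono' measurableSet_ball fun w hw => ?_
  have hw1 : ‖w‖ < 1 := by simpa using hw
  have hw0 := norm_nonneg w
  have hpos : 0 < 1 - ‖w‖ ^ 2 := by nlinarith
  calc ∫⁻ x in Ioo (0 : ℝ) 1, S.indicator (fun q => F q.2) (x, w)
      -- If `|w - xζ| < (1-x)/2` then `|w| < (1+x)/2`, that is, `x > 1 - 2(1-|w|)`.
      ≤ ∫⁻ x in Ioo (0 : ℝ) 1, (Ioo (1 - 2 * (1 - ‖w‖)) 1).indicator (fun _ => F w) x := by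
        refine setLIntegral_mono' measurableSet_Ioo fun x hx => ?_
        by_cases hxw : (x, w) ∈ S
        · rw [indicator_of_mem hxw, indicator_of_mem]
          refine ⟨?_, hx.2⟩
          have h3 : ‖w - x * ζ‖ < (1 - x) / 2 := hxw
          have h4 := norm_sub_norm_le w (x * ζ)
          rw [hxn x hx] at h4
          linarith
        · rw [indicator_of_notMem hxw]; exact zero_le
    _ ≤ ∫⁻ x, (Ioo (1 - 2 * (1 - ‖w‖)) 1).indicator (fun _ => F w) x := setLIntegral_le_lintegral _ _
    _ = F w * ENNReal.ofReal (2 * (1 - ‖w‖)) := by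
        rw [lintegral_indicator measurableSet_Ioo, setLIntegral_const, Real.volume_Ioo]
        congr 2; ring
    _ ≤ F w * ENNReal.ofReal (2 * (1 - ‖w‖ ^ 2)) := by
        gcongr; nlinarith
    _ = _ := by
        simp only [hF]
        rw [mul_assoc, ← ENNReal.ofReal_mul (by positivity), mul_left_comm (ENNReal.ofReal 2),
          ← ENNReal.ofReal_mul (by positivity)]
        congr 2
        rw [show p - 2 = p - 3 + 1 by ring, Real.rpow_add_one hpos.ne']
        ring

lemma lintegral_inv_one_sub {r : ℝ} (h0 : 0 ≤ r) (h1 : r < 1) :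
    ∫⁻ x in Ioo (0 : ℝ) r, ENNReal.ofReal (1 - x)⁻¹ = ENNReal.ofReal (-Real.log (1 - r)) := by
  have hcont : ContinuousOn (fun x : ℝ => (1 - x)⁻¹) (uIcc 0 r) := by
    refine ContinuousOn.inv₀ (by fun_prop) fun x hx => ?_
    rw [uIcc_of_le h0] at hx
    linarith [hx.2]
  have hint := hcont.intervalIntegrable (μ := volume)
  have hI : ∫ x in (0 : ℝ)..r, (1 - x)⁻¹ = -Real.log (1 - r) := by
    rw [intervalIntegral.integral_eq_sub_of_hasDerivAt (f := fun x => -Real.log (1 - x))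
      (fun x hx => ?_) hint]
    · simp
    · rw [uIcc_of_le h0] at hx
      have hx1 : 1 - x ≠ 0 := by linarith [hx.2]
      have := ((hasDerivAt_id x).const_sub 1).log hx1
      simpa [neg_div] using this.fun_neg
  rw [← hI, intervalIntegral.integral_of_le h0, integral_Ioc_eq_integral_Ioo,
    ofReal_integral_eq_lintegral_ofReal]
  · exact ((intervalIntegrable_iff_integrableOn_Ioo_of_le h0).1 hint)
  · refine (ae_restrict_iff' measurableSet_Ioo).2 (Filter.Eventually.of_forall fun x hx => ?_)
    exact inv_nonneg.2 (by linarith [hx.2])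

lemma log_exp_one_div {r : ℝ} (h1 : r < 1) :
    Real.log (Real.exp 1 / (1 - r)) = 1 - Real.log (1 - r) := by
  rw [Real.log_div (Real.exp_pos 1).ne' (by linarith), Real.log_exp]

lemma one_le_log_exp_one_div {r : ℝ} (h0 : 0 ≤ r) (h1 : r < 1) :
    1 ≤ Real.log (Real.exp 1 / (1 - r)) := by
  rw [log_exp_one_div h1]
  linarith [Real.log_nonpos (by linarith : 0 ≤ 1 - r) (by linarith)]

lemma log_exp_one_div_mono {r t : ℝ} (hrt : r ≤ t) (h1 : t < 1) :
    Real.log (Real.exp 1 / (1 - r)) ≤ Real.log (Real.exp 1 / (1 - t)) := by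
  rw [log_exp_one_div h1, log_exp_one_div (hrt.trans_lt h1)]
  linarith [Real.log_le_log (by linarith : 0 < 1 - t) (by linarith : 1 - t ≤ 1 - r)]

lemma enorm_sub_le_lintegral_ray (f : HolDisc) {ζ : ℂ} (hζ : ‖ζ‖ = 1) {r : ℝ} (h0 : 0 ≤ r)
    (h1 : r < 1) :
    ‖f.1 (r * ζ) - f.1 0‖ₑ ≤ ∫⁻ x in Ioo (0 : ℝ) r, ‖deriv f.1 (x * ζ)‖ₑ := by
  have hx : ∀ x ∈ Icc (0 : ℝ) r, ‖(x : ℂ) * ζ‖ < 1 := fun x hx => by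
    simpa [hζ, abs_of_nonneg hx.1] using hx.2.trans_lt h1
  have hcont : ContinuousOn (fun x : ℝ => deriv f.1 (x * ζ) * ζ) (uIcc 0 r) := by
    refine ContinuousOn.mul ?_ continuousOn_const
    refine (holDisc_differentiableOn_deriv f).continuousOn.comp (by fun_prop) fun x hx' => ?_
    rw [uIcc_of_le h0] at hx'
    simpa using hx x hx'
  have h := intervalIntegral.integral_eq_sub_of_hasDerivAt (a := 0) (b := r)
    (f := fun x : ℝ => f.1 (x * ζ)) (f' := fun x : ℝ => deriv f.1 (x * ζ) * ζ) (fun x hx' => by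
      rw [uIcc_of_le h0] at hx'
      have hd := (holDisc_differentiableAt f (hx x hx')).hasDerivAt
      have h2 : HasDerivAt (fun w : ℂ => f.1 (w * ζ)) (deriv f.1 (x * ζ) * ζ) (x : ℂ) := by
        simpa [Function.comp_def] using hd.comp (x : ℂ) ((hasDerivAt_id (x : ℂ)).mul_const ζ)
      exact h2.comp_ofReal) (hcont.intervalIntegrable)
  simp only [Complex.ofReal_zero, zero_mul] at h
  rw [← h, intervalIntegral.integral_of_le h0, integral_Ioc_eq_integral_Ioo]
  refine (enorm_integral_le_lintegral_enorm _).trans (le_of_eq ?_)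
  refine lintegral_congr fun x => ?_
  rw [enorm_mul, show ‖ζ‖ₑ = 1 by rw [← ofReal_norm, hζ, ENNReal.ofReal_one], mul_one]

/-- Hölder along the radius through `z`: the factor `|f'| (1-x)^{1/q}` has bounded `L^p` norm
because `p/q = p-1` is the weight of `lintegral_ray_le`, and `(1-x)^{-1/q}` has `L^q` norm equal to
a logarithm to the power `1/q`. -/
lemma norm_le_of_besov {p q : ℝ} (hpq : p.HolderConjugate q) : ∃ C : ℝ, 0 ≤ C ∧ ∀ f ∈ Besov p,
    ∀ z : ℂ, ‖z‖ < 1 → ‖f.1 z‖ ≤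
      C * (besovNorm p f).toReal * Real.log (Real.exp 1 / (1 - ‖z‖)) ^ (1 / q) := by
  have hp0 : 0 < p := hpq.pos
  have hq0 : 0 < q := hpq.symm.pos
  have hpq' : p / q = p - 1 := hpq.div_conj_eq_sub_one
  set A : ℝ := 2 * 4 ^ (|p - 3| + 1) with hA
  have hA0 : 0 ≤ A := by positivity
  refine ⟨1 + A ^ (1 / p), by positivity, fun f hf z hz => ?_⟩
  obtain ⟨ζ, hζ, hzζ⟩ : ∃ ζ : ℂ, ‖ζ‖ = 1 ∧ z = ‖z‖ * ζ :=
    ⟨Complex.exp (Complex.arg z * Complex.I), Complex.norm_exp_ofReal_mul_I _,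
      (Complex.norm_mul_exp_arg_mul_I z).symm⟩
  set r := ‖z‖ with hr
  have hr0 : 0 ≤ r := norm_nonneg z
  set N := (besovNorm p f).toReal with hN'
  have hN0 : 0 ≤ N := ENNReal.toReal_nonneg
  have hN : besovNorm p f = ENNReal.ofReal N := (ENNReal.ofReal_toReal (ne_of_lt hf)).symm
  set L := Real.log (Real.exp 1 / (1 - r)) with hL
  have hL1 : 1 ≤ L := one_le_log_exp_one_div hr0 hz
  have hf0 : ‖f.1 0‖ ≤ N := by
    rw [← ENNReal.ofReal_le_ofReal_iff hN0, ← hN, ofReal_norm, besovNorm]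
    exact le_self_add
  have hmeas : Measurable fun x : ℝ => ‖deriv f.1 (x * ζ)‖ₑ :=
    ((measurable_deriv f.1).comp (by fun_prop : Measurable fun x : ℝ => (x : ℂ) * ζ)).enorm
  have hH := ENNReal.lintegral_mul_le_Lp_mul_Lq (volume.restrict (Ioo (0 : ℝ) r)) hpq
    (f := fun x : ℝ => ‖deriv f.1 (x * ζ)‖ₑ * ENNReal.ofReal ((1 - x) ^ (1 / q)))
    (g := fun x => ENNReal.ofReal ((1 - x) ^ (-(1 / q))))
    (hmeas.mul (by fun_prop)).aemeasurable (by fun_prop)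
  have e1 : ∫⁻ x in Ioo (0 : ℝ) r, ‖deriv f.1 (x * ζ)‖ₑ = ∫⁻ x in Ioo (0 : ℝ) r,
      ((fun x : ℝ => ‖deriv f.1 (x * ζ)‖ₑ * ENNReal.ofReal ((1 - x) ^ (1 / q))) *
        (fun x => ENNReal.ofReal ((1 - x) ^ (-(1 / q))))) x := by
    refine setLIntegral_congr_fun measurableSet_Ioo fun x hx => ?_
    have hx1 : 0 < 1 - x := by linarith [hx.2]
    simp only [Pi.mul_apply]
    rw [mul_assoc, ← ENNReal.ofReal_mul (by positivity), ← Real.rpow_add hx1, add_neg_cancel,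
      Real.rpow_zero, ENNReal.ofReal_one, mul_one]
  have e2 : ∫⁻ x in Ioo (0 : ℝ) r,
      (‖deriv f.1 (x * ζ)‖ₑ * ENNReal.ofReal ((1 - x) ^ (1 / q))) ^ p ≤
      ENNReal.ofReal (A * N ^ p) := by
    calc _ ≤ ∫⁻ x in Ioo (0 : ℝ) r,
          ‖deriv f.1 (x * ζ)‖ₑ ^ p * ENNReal.ofReal ((1 - x) ^ (p - 1)) := by
          refine setLIntegral_mono' measurableSet_Ioo fun x hx => le_of_eq ?_
          have hx1 : 0 < 1 - x := by linarith [hx.2]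
          rw [ENNReal.mul_rpow_of_nonneg _ _ hp0.le,
            ENNReal.ofReal_rpow_of_nonneg (by positivity) hp0.le, ← Real.rpow_mul hx1.le,
            one_div_mul_eq_div, hpq']
      _ ≤ ∫⁻ x in Ioo (0 : ℝ) 1,
          ‖deriv f.1 (x * ζ)‖ₑ ^ p * ENNReal.ofReal ((1 - x) ^ (p - 1)) :=
          lintegral_mono_set (Ioo_subset_Ioo_right hz.le)
      _ ≤ _ := lintegral_ray_le hpq.lt.le (holDisc_differentiableOn_deriv f)
          (measurable_deriv f.1) hζ
      _ ≤ _ := mul_le_mul_right (lintegral_deriv_le_besovNorm hp0 f) _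
      _ = _ := by
          rw [hN, ENNReal.ofReal_rpow_of_nonneg hN0 hp0.le, ← ENNReal.ofReal_mul (by positivity),
            ← ENNReal.ofReal_mul (by positivity), ← mul_assoc, div_mul_cancel₀ _ Real.pi_ne_zero]
  have e3 : ∫⁻ x in Ioo (0 : ℝ) r, ENNReal.ofReal ((1 - x) ^ (-(1 / q))) ^ q ≤
      ENNReal.ofReal L := by
    calc _ = ∫⁻ x in Ioo (0 : ℝ) r, ENNReal.ofReal (1 - x)⁻¹ := by
          refine setLIntegral_congr_fun measurableSet_Ioo fun x hx => ?_
          have hx1 : 0 < 1 - x := by linarith [hx.2]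
          rw [ENNReal.ofReal_rpow_of_nonneg (by positivity) hq0.le, ← Real.rpow_mul hx1.le,
            neg_mul, one_div_mul_cancel hq0.ne', Real.rpow_neg_one]
      _ = _ := lintegral_inv_one_sub hr0 hz
      _ ≤ _ := by
          rw [hL, log_exp_one_div hz]
          exact ENNReal.ofReal_le_ofReal (by linarith)
  have h5 : ‖f.1 z - f.1 0‖ ≤ A ^ (1 / p) * N * L ^ (1 / q) := by
    rw [← ENNReal.ofReal_le_ofReal_iff (by positivity), ofReal_norm]
    calc _ ≤ _ := by
          conv_lhs => rw [hzζ]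
          exact enorm_sub_le_lintegral_ray f hζ hr0 hz
      _ ≤ _ := e1.trans_le hH
      _ ≤ ENNReal.ofReal (A * N ^ p) ^ (1 / p) * ENNReal.ofReal L ^ (1 / q) := by
          gcongr
      _ = _ := by
          rw [ENNReal.ofReal_rpow_of_nonneg (by positivity) (by positivity),
            ENNReal.ofReal_rpow_of_nonneg (by positivity) (by positivity),
            ← ENNReal.ofReal_mul (by positivity), Real.mul_rpow hA0 (by positivity),
            ← Real.rpow_mul hN0, mul_one_div_cancel hp0.ne', Real.rpow_one]
  -- The `e` inside the logarithm makes `L ≥ 1`, so the term `|f(0)|` is absorbed.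
  have h6 : 1 ≤ L ^ (1 / q) := Real.one_le_rpow hL1 (by positivity)
  calc ‖f.1 z‖ ≤ ‖f.1 0‖ + ‖f.1 z - f.1 0‖ := norm_le_insert' _ _
    _ ≤ N * L ^ (1 / q) + A ^ (1 / p) * N * L ^ (1 / q) := by
        gcongr
        nlinarith
    _ = _ := by ring

/-! ### Integral representation of the operator and of its derivative -/

/-- The function `f(w)/(1-w)`, whose average over dilations is `C_μ f`. -/
noncomputable def cesaroKernel (f : ℂ → ℂ) (w : ℂ) : ℂ := f w / (1 - w)

lemma one_sub_ne_zero_of_norm_lt_one {w : ℂ} (hw : ‖w‖ < 1) : 1 - w ≠ 0 := fun h => by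
  rw [← sub_eq_zero.1 h, norm_one] at hw
  exact lt_irrefl _ hw

lemma hasDerivAt_cesaroKernel (f : HolDisc) {w : ℂ} (hw : ‖w‖ < 1) :
    HasDerivAt (cesaroKernel f.1) (deriv f.1 w / (1 - w) + f.1 w / (1 - w) ^ 2) w := by
  have h1 := one_sub_ne_zero_of_norm_lt_one hw
  have h := (holDisc_differentiableAt f hw).hasDerivAt.div ((hasDerivAt_id w).const_sub 1) h1
  refine h.congr_deriv ?_
  simp only [id]
  field_simp
  ring

/-- The partial sums of the coefficients arise from the Cauchy product with the geometric series. -/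
lemma hasSum_cesaroKernel (f : HolDisc) {w : ℂ} (hw : ‖w‖ < 1) :
    HasSum (fun n => (∑ k ∈ Finset.range (n + 1), taylorCoeff f.1 k) * w ^ n)
      (cesaroKernel f.1 w) := by
  have h1 : HasSum (fun n => taylorCoeff f.1 n * w ^ n) (f.1 w) := by
    have h := Complex.hasSum_taylorSeries_on_ball (f := f.1) (c := 0) (r := 1) (z := w) f.2.1
      (by simpa using hw)
    refine h.congr_fun fun n => ?_
    simp [taylorCoeff, div_eq_inv_mul]
    ring
  have h2 := hasSum_geometric_of_norm_lt_one hw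
  have h3 := hasSum_sum_range_mul_of_summable_norm (f := fun n => taylorCoeff f.1 n * w ^ n)
    (g := fun n => w ^ n)
    (by simpa using summable_taylorCoeff f.2.1 (norm_nonneg w) hw) (by
      simpa using summable_geometric_of_lt_one (norm_nonneg w) hw)
  rw [h1.tsum_eq, h2.tsum_eq, ← div_eq_mul_inv] at h3
  refine h3.congr_fun fun n => ?_
  rw [Finset.sum_mul]
  refine Finset.sum_congr rfl fun k hk => ?_
  rw [mul_assoc, ← pow_add, Nat.add_sub_cancel' (Nat.lt_succ_iff.mp (Finset.mem_range.mp hk))]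

lemma norm_mul_lt_one {z : ℂ} (hz : ‖z‖ < 1) (t : Ico (0 : ℝ) 1) : ‖(t : ℂ) * z‖ < 1 := by
  rw [norm_mul, Complex.norm_real, Real.norm_of_nonneg t.2.1]
  have := t.2.1
  have := t.2.2
  nlinarith [norm_nonneg z]

lemma cesaroLike_eq_integral (μ : Measure (Ico (0 : ℝ) 1)) [IsFiniteMeasure μ] (f : HolDisc)
    {z : ℂ} (hz : ‖z‖ < 1) :
    (cesaroLike μ f).1 z = ∫ t, cesaroKernel f.1 ((t : ℝ) * z) ∂μ := by
  set A : ℕ → ℂ := fun n => ∑ k ∈ Finset.range (n + 1), taylorCoeff f.1 k with hA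
  have hpow : ∀ n : ℕ, Integrable (fun t : Ico (0 : ℝ) 1 => (t : ℝ) ^ n) μ := fun n => by
    refine Integrable.of_bound (C := 1) (by fun_prop) (Filter.Eventually.of_forall fun t => ?_)
    rw [norm_pow, Real.norm_of_nonneg t.2.1]
    exact pow_le_one₀ t.2.1 t.2.2.le
  have hint : ∀ n, Integrable (fun t : Ico (0 : ℝ) 1 => A n * ((t : ℝ) * z) ^ n) μ := fun n => by
    have := ((hpow n).ofReal (𝕜 := ℂ)).const_mul (A n * z ^ n)
    refine this.congr (Filter.Eventually.of_forall fun t => ?_)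
    simp only [Complex.coe_algebraMap]
    push_cast
    ring
  have h := hasSum_integral_of_summable_integral_norm hint ?_
  · have e1 : ∀ n, ∫ t : Ico (0 : ℝ) 1, A n * ((t : ℝ) * z) ^ n ∂μ =
        cesaroCoeff μ f.1 n * z ^ n := fun n => by
      rw [cesaroCoeff, moment01, ← integral_complex_ofReal, mul_assoc,
        ← integral_mul_const]
      refine integral_congr_ae (Filter.Eventually.of_forall fun t => ?_)
      simp only [hA]
      push_cast
      ring
    simp only [e1] at h
    have e2 : (cesaroLike μ f).1 z = ∑' n, cesaroCoeff μ f.1 n * z ^ n :=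
      indicator_of_mem (s := ball (0 : ℂ) 1) (by simpa using hz)
        fun z => ∑' n, cesaroCoeff μ f.1 n * z ^ n
    rw [e2, h.tsum_eq]
    refine integral_congr_ae (Filter.Eventually.of_forall fun t => ?_)
    exact (hasSum_cesaroKernel f (norm_mul_lt_one hz t)).tsum_eq
  -- As `t ≥ 0`, the integral of the norm of the `n`-th term is exactly the norm of the `n`-th term
  -- of the series of `C_μ f`, so its absolute convergence justifies the interchange.
  · refine (summable_cesaroCoeff μ f.2.1 (norm_nonneg z) hz).congr fun n => ?_
    have h0 : 0 ≤ moment01 μ n := integral_nonneg fun t => pow_nonneg t.2.1 n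
    rw [cesaroCoeff, norm_mul, Complex.norm_real, Real.norm_of_nonneg h0, moment01, mul_assoc,
      ← integral_mul_const]
    refine integral_congr_ae (Filter.Eventually.of_forall fun t => ?_)
    simp only [hA, norm_mul, norm_pow, Complex.norm_real, Real.norm_of_nonneg t.2.1, mul_pow]
    ring

/-- Differentiation under the integral sign. A constant dominates near `z`, because `tw` stays in a
fixed compact disc of radius `r < 1` for all `t` once `|w| ≤ r`. -/
lemma deriv_cesaroLike_eq_integral (μ : Measure (Ico (0 : ℝ) 1)) [IsFiniteMeasure μ] (f : HolDisc)
    {z : ℂ} (hz : ‖z‖ < 1) :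
    Integrable (fun t : Ico (0 : ℝ) 1 => deriv (cesaroKernel f.1) ((t : ℝ) * z) * (t : ℝ)) μ ∧
    deriv (cesaroLike μ f).1 z =
      ∫ t : Ico (0 : ℝ) 1, deriv (cesaroKernel f.1) ((t : ℝ) * z) * (t : ℝ) ∂μ := by
  have hK : DifferentiableOn ℂ (cesaroKernel f.1) (ball 0 1) := fun w hw =>
    (hasDerivAt_cesaroKernel f (by simpa using hw)).differentiableAt.differentiableWithinAt
  have hK' : DifferentiableOn ℂ (deriv (cesaroKernel f.1)) (ball 0 1) := hK.deriv isOpen_ball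
  obtain ⟨r, hzr, hr1⟩ := exists_between hz
  have hr0 : 0 ≤ r := (norm_nonneg z).trans hzr.le
  obtain ⟨B, hB⟩ := (isCompact_closedBall (0 : ℂ) r).exists_bound_of_continuousOn
    (hK'.continuousOn.mono (closedBall_subset_ball hr1))
  have hcontK : ∀ w : ℂ, ‖w‖ < 1 →
      Continuous fun t : Ico (0 : ℝ) 1 => cesaroKernel f.1 ((t : ℝ) * w) := fun w hw =>
    hK.continuousOn.comp_continuous (by fun_prop) fun t => by
      simpa using norm_mul_lt_one hw t
  have hcontK' : ∀ w : ℂ, ‖w‖ < 1 →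
      Continuous fun t : Ico (0 : ℝ) 1 => deriv (cesaroKernel f.1) ((t : ℝ) * w) := fun w hw =>
    hK'.continuousOn.comp_continuous (by fun_prop) fun t => by
      simpa using norm_mul_lt_one hw t
  have hs : ball (0 : ℂ) r ∈ nhds z := isOpen_ball.mem_nhds (by simpa using hzr)
  have htw : ∀ w ∈ closedBall (0 : ℂ) r, ∀ t : Ico (0 : ℝ) 1, (t : ℂ) * w ∈ closedBall (0 : ℂ) r := by
    intro w hw t
    rw [mem_closedBall_zero_iff] at hw ⊢
    rw [norm_mul, Complex.norm_real, Real.norm_of_nonneg t.2.1]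
    have := t.2.1
    have := t.2.2
    nlinarith [norm_nonneg w]
  obtain ⟨B', hB'⟩ := (isCompact_closedBall (0 : ℂ) r).exists_bound_of_continuousOn
    (hK.continuousOn.mono (closedBall_subset_ball hr1))
  have key := hasDerivAt_integral_of_dominated_loc_of_deriv_le (μ := μ) (𝕜 := ℂ)
    (F := fun w (t : Ico (0 : ℝ) 1) => cesaroKernel f.1 ((t : ℝ) * w))
    (F' := fun w (t : Ico (0 : ℝ) 1) => deriv (cesaroKernel f.1) ((t : ℝ) * w) * (t : ℝ))
    (x₀ := z) (bound := fun _ => B) hs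
    (Filter.eventually_of_mem hs fun w hw => (hcontK w
      ((mem_ball_zero_iff.1 hw).trans hr1)).aestronglyMeasurable)
    (Integrable.of_bound (C := B') (hcontK z hz).aestronglyMeasurable
      (Filter.Eventually.of_forall fun t => hB' _ (htw z (by simpa using hzr.le) t)))
    ((hcontK' z hz).mul (by fun_prop)).aestronglyMeasurable
    (Filter.Eventually.of_forall fun t w hw => by
      have h := hB _ (htw w (ball_subset_closedBall hw) t)
      rw [norm_mul, Complex.norm_real, Real.norm_of_nonneg t.2.1]
      have := t.2.2
      nlinarith [norm_nonneg (deriv (cesaroKernel f.1) ((t : ℝ) * w)), t.2.1])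
    (integrable_const B)
    (Filter.Eventually.of_forall fun t w hw => by
      have hd := (hasDerivAt_cesaroKernel f (norm_mul_lt_one
        ((mem_ball_zero_iff.1 hw).trans hr1) t)).differentiableAt.hasDerivAt
      simpa [Function.comp_def] using
        hd.comp w ((hasDerivAt_id w).const_mul (t : ℂ)))
  refine ⟨key.1, ?_⟩
  rw [← key.2.deriv]
  refine Filter.EventuallyEq.deriv_eq (Filter.eventually_of_mem hs fun w hw => ?_)
  exact cesaroLike_eq_integral μ f ((mem_ball_zero_iff.1 hw).trans hr1)

/-! ### Logarithmic weights and Carleson measures -/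

lemma logWeight_mono {β γ : ℝ} (hβ : 0 ≤ β) (hγ : γ ≤ 0) {r t : ℝ} (h0 : 0 ≤ r) (hrt : r ≤ t)
    (h1 : t < 1) :
    Real.log (Real.exp 1 / (1 - r)) ^ β * (1 - r) ^ γ ≤
      Real.log (Real.exp 1 / (1 - t)) ^ β * (1 - t) ^ γ := by
  have hr1 : 0 < 1 - r := by linarith
  have a1 := one_le_log_exp_one_div h0 (hrt.trans_lt h1)
  have a2 := log_exp_one_div_mono hrt h1
  refine mul_le_mul (Real.rpow_le_rpow (by linarith) a2 hβ)
    (Real.rpow_le_rpow_of_nonpos (by linarith) (by linarith) hγ) (by positivity) ?_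
  exact Real.rpow_nonneg (by linarith) _

/-- Integrals of truncated logarithmic weights against logarithmic Carleson measures. -/
lemma integral_logWeight_le {β a : ℝ} (hβ : 0 ≤ β) (ha : a < 1) {μ : Measure (Ico (0 : ℝ) 1)}
    [IsFiniteMeasure μ] (hμ : IsLogCarleson β 1 μ) :
    ∃ K : ℝ, 0 ≤ K ∧ ∀ r : ℝ, 0 ≤ r → r < 1 →
      ∫ t : Ico (0 : ℝ) 1, Real.log (Real.exp 1 / (1 - min (t : ℝ) r)) ^ β *
        (1 - min (t : ℝ) r) ^ (a - 2) ∂μ ≤ K * (1 - r) ^ (a - 1) := by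
  set ψ : ℝ → ℝ := fun x => Real.log (Real.exp 1 / (1 - x)) ^ β * (1 - x) ^ (a - 2) with hψ
  have hψm : Measurable ψ := by fun_prop
  have hmono : ∀ {r t : ℝ}, 0 ≤ r → r ≤ t → t < 1 → ψ r ≤ ψ t := fun h0 hrt h1 =>
    logWeight_mono hβ (by linarith) h0 hrt h1
  have hψ0 : ∀ r, 0 ≤ r → r < 1 → 0 ≤ ψ r := fun r h0 h1 => by
    have := one_le_log_exp_one_div h0 h1
    exact mul_nonneg (Real.rpow_nonneg (by linarith) _) (Real.rpow_nonneg (by linarith) _)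
  have hint : ∀ r, 0 ≤ r → r < 1 → Integrable (fun t : Ico (0 : ℝ) 1 => ψ (min (t : ℝ) r)) μ := by
    intro r h0 h1
    refine Integrable.of_bound (C := ψ r)
      (hψm.comp (by fun_prop : Measurable fun t : Ico (0 : ℝ) 1 => min (t : ℝ) r)).aestronglyMeasurable
      (Filter.Eventually.of_forall fun t => ?_)
    have h2 : 0 ≤ min (t : ℝ) r := le_min t.2.1 h0
    rw [Real.norm_of_nonneg (hψ0 _ h2 (min_lt_of_right_lt h1))]
    exact hmono h2 (min_le_right _ _) h1
  obtain ⟨C, hC⟩ := hμ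
  have hC' : ∀ t, 0 ≤ t → (ht1 : t < 1) → ∀ ht0 : 0 ≤ t,
      μ.real (Ici ⟨t, ht0, ht1⟩) * Real.log (Real.exp 1 / (1 - t)) ^ β ≤ C * (1 - t) := by
    intro t _ ht1 ht0
    have h := hC ⟨⟨t, ht0, ht1⟩, rfl⟩
    simp only [Real.rpow_one] at h
    rwa [div_le_iff₀ (by linarith)] at h
  have hC0 : 0 ≤ C := by
    have h := hC' 0 le_rfl one_pos le_rfl
    have h2 := one_le_log_exp_one_div le_rfl one_pos
    have : 0 ≤ μ.real (Ici ⟨0, le_rfl, one_pos⟩) * Real.log (Real.exp 1 / (1 - 0)) ^ β :=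
      mul_nonneg measureReal_nonneg (Real.rpow_nonneg (by linarith) _)
    linarith
  set D : ℝ := C * 2 * 2 ^ β with hD
  have hD0 : 0 ≤ D := by positivity
  have h2a : (2 : ℝ) ^ (a - 1) < 1 := Real.rpow_lt_one_of_one_lt_of_neg (by norm_num) (by linarith)
  set M : ℝ := μ.real univ with hM
  have hM0 : 0 ≤ M := measureReal_nonneg
  -- The first entry settles `r ≤ 1/2`. The second closes the induction, where `K 2^{a-1} + D ≤ K`
  -- is needed; this is where `a < 1` enters.
  set K : ℝ := max (ψ (1 / 2) * M) (D / (1 - 2 ^ (a - 1))) with hK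
  have hK1 : ψ (1 / 2) * M ≤ K := le_max_left _ _
  have hK2 : D ≤ K * (1 - 2 ^ (a - 1)) := by
    rw [← div_le_iff₀ (by linarith)]; exact le_max_right _ _
  have hK0 : 0 ≤ K := le_trans (mul_nonneg (hψ0 _ (by norm_num) (by norm_num)) hM0) hK1
  have hsmall : ∀ r, 0 ≤ r → r ≤ 1 / 2 → ∫ t : Ico (0 : ℝ) 1, ψ (min (t : ℝ) r) ∂μ ≤
      K * (1 - r) ^ (a - 1) := by
    intro r h0 h1
    have h3 : 1 ≤ (1 - r) ^ (a - 1) :=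
      Real.one_le_rpow_of_pos_of_le_one_of_nonpos (by linarith) (by linarith) (by linarith)
    calc _ ≤ ∫ t : Ico (0 : ℝ) 1, ψ (1 / 2) ∂μ := by
          refine integral_mono (hint r h0 (by linarith)) (integrable_const _) fun t => ?_
          exact hmono (le_min t.2.1 h0) ((min_le_right _ _).trans h1) (by norm_num)
      _ = ψ (1 / 2) * M := by rw [integral_const, smul_eq_mul, mul_comm]
      _ ≤ K * 1 := by linarith
      _ ≤ _ := by gcongr
  -- Replacing `r` by `2r-1` doubles `1-r`. The two truncated weights differ only on `[2r-1,1)`, by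
  -- at most `ψ r`, and the Carleson condition bounds the mass of that interval.
  have hstep : ∀ r, 1 / 2 < r → r < 1 → ∫ t : Ico (0 : ℝ) 1, ψ (min (t : ℝ) r) ∂μ ≤
      ∫ t : Ico (0 : ℝ) 1, ψ (min (t : ℝ) (2 * r - 1)) ∂μ + D * (1 - r) ^ (a - 1) := by
    intro r h0 h1
    have hr' : 0 ≤ 2 * r - 1 := by linarith
    have hr1 : 2 * r - 1 < 1 := by linarith
    set e : Ico (0 : ℝ) 1 := ⟨2 * r - 1, hr', hr1⟩ with he
    have hr : 0 < 1 - r := by linarith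
    have hL1 := one_le_log_exp_one_div hr' hr1
    set L := Real.log (Real.exp 1 / (1 - (2 * r - 1))) with hL
    -- Doubling `1-r` costs at most a factor 2 in the logarithm, hence `2^β` in `D`.
    have hLr : Real.log (Real.exp 1 / (1 - r)) ≤ 2 * L := by
      rw [hL, log_exp_one_div hr1, log_exp_one_div h1, show 1 - (2 * r - 1) = 2 * (1 - r) by ring,
        Real.log_mul (by norm_num) hr.ne']
      have h5 : 2 * Real.log 2 + Real.log (1 - r) ≤ 1 := by
        have h6 : Real.log (1 - r) ≤ Real.log (1 / 2) := Real.log_le_log hr (by linarith)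
        rw [one_div, Real.log_inv] at h6
        linarith [Real.log_two_lt_d9]
      linarith
    have hψr : ψ r * μ.real (Ici e) ≤ D * (1 - r) ^ (a - 1) := by
      have h7 := hC' (2 * r - 1) hr' hr1 hr'
      have h8 : Real.log (Real.exp 1 / (1 - r)) ^ β ≤ 2 ^ β * L ^ β := by
        rw [← Real.mul_rpow (by norm_num) (by linarith)]
        have := one_le_log_exp_one_div (by linarith : 0 ≤ r) h1
        exact Real.rpow_le_rpow (by linarith) hLr hβ
      calc ψ r * μ.real (Ici e)
          ≤ (2 ^ β * L ^ β * (1 - r) ^ (a - 2)) * μ.real (Ici e) := by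
            simp only [hψ]
            gcongr
        _ = 2 ^ β * (1 - r) ^ (a - 2) * (μ.real (Ici e) * L ^ β) := by ring
        _ ≤ 2 ^ β * (1 - r) ^ (a - 2) * (C * (1 - (2 * r - 1))) := by gcongr
        _ = D * (1 - r) ^ (a - 1) := by
            rw [show a - 1 = a - 2 + 1 by ring, Real.rpow_add_one hr.ne', hD]
            ring
    calc _ ≤ ∫ t : Ico (0 : ℝ) 1, (ψ (min (t : ℝ) (2 * r - 1)) +
            (Ici e).indicator (fun _ => ψ r) t) ∂μ := by
          refine integral_mono (hint r (by linarith) h1) ((hint _ hr' hr1).add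
            ((integrable_const _).indicator measurableSet_Ici)) fun t => ?_
          simp only
          by_cases ht : t ∈ Ici e
          · rw [indicator_of_mem ht]
            have h9 := hψ0 _ (le_min t.2.1 hr') (min_lt_of_right_lt hr1)
            have := hmono (le_min t.2.1 (by linarith : 0 ≤ r)) (min_le_right (t : ℝ) r) h1
            linarith
          · rw [indicator_of_notMem ht, add_zero]
            have ht' : (t : ℝ) < 2 * r - 1 := by
              have : t < e := not_le.1 ht
              exact this
            rw [min_eq_left ht'.le, min_eq_left (by linarith)]
      _ = ∫ t : Ico (0 : ℝ) 1, ψ (min (t : ℝ) (2 * r - 1)) ∂μ + ψ r * μ.real (Ici e) := by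
          rw [integral_add (hint _ hr' hr1) ((integrable_const _).indicator measurableSet_Ici),
            integral_indicator_const _ measurableSet_Ici, smul_eq_mul, mul_comm (ψ r)]
      _ ≤ _ := by gcongr
  -- The induction counts how many doublings of `1-r` are enough to reach `r ≤ 1/2`.
  have hind : ∀ n : ℕ, ∀ r, 0 ≤ r → r < 1 → (1 / 2 : ℝ) ^ n ≤ 1 - r →
      ∫ t : Ico (0 : ℝ) 1, ψ (min (t : ℝ) r) ∂μ ≤ K * (1 - r) ^ (a - 1) := by
    intro n
    induction n with
    | zero => intro r h0 h1 h2; exact hsmall r h0 (by simp at h2; linarith)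
    | succ n ih =>
      intro r h0 h1 h2
      rcases le_or_gt r (1 / 2) with h | h
      · exact hsmall r h0 h
      · have h3 := ih (2 * r - 1) (by linarith) (by linarith) (by rw [pow_succ] at h2; linarith)
        refine (hstep r h h1).trans ?_
        rw [show 1 - (2 * r - 1) = 2 * (1 - r) by ring, Real.mul_rpow (by norm_num)
          (by linarith)] at h3
        have : 0 ≤ (1 - r) ^ (a - 1) := Real.rpow_nonneg (by linarith) _
        nlinarith
  refine ⟨K, hK0, fun r h0 h1 => ?_⟩
  obtain ⟨n, hn⟩ := exists_pow_lt_of_lt_one (by linarith : 0 < 1 - r) (by norm_num : (1 / 2 : ℝ) < 1)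
  exact hind n r h0 h1 hn.le

/-! ### Circular means and membership in the mean Lipschitz space -/

/-- Moving from `tz` to `z` costs `|tz - z| ≤ 1-t`, which is itself at most `|1-tz|`. -/
lemma norm_one_sub_le_two_mul {z : ℂ} (hz : ‖z‖ ≤ 1) {t : ℝ} (h0 : 0 ≤ t) (h1 : t ≤ 1) :
    ‖1 - z‖ ≤ 2 * ‖1 - t * z‖ := by
  have a1 : ‖(t : ℂ) * z‖ ≤ t := by
    rw [norm_mul, Complex.norm_real, Real.norm_of_nonneg h0]
    nlinarith [norm_nonneg z]
  have a2 : 1 - t ≤ ‖1 - t * z‖ := by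
    have := norm_sub_norm_le (1 : ℂ) (t * z)
    rw [norm_one] at this
    linarith
  have a3 : ‖(t : ℂ) * z - z‖ ≤ 1 - t := by
    rw [← sub_one_mul, norm_mul, ← Complex.ofReal_one, ← Complex.ofReal_sub, Complex.norm_real,
      Real.norm_of_nonpos (by linarith)]
    nlinarith [norm_nonneg z]
  have a4 := norm_add_le (1 - t * z) (t * z - z)
  rw [sub_add_sub_cancel] at a4
  linarith

/-- Reduction to `r = 1`, where `|1 - e^{iθ}| = 2|sin(θ/2)|` and Jordan's inequality applies. -/
lemma abs_div_pi_le_norm_one_sub_exp {r θ : ℝ} (h0 : 0 ≤ r) (h1 : r ≤ 1) (hθ : |θ| ≤ Real.pi) :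
    |θ| / Real.pi ≤ ‖1 - r * Complex.exp (θ * Complex.I)‖ := by
  have h := norm_one_sub_le_two_mul (z := Complex.exp (θ * Complex.I))
    (Complex.norm_exp_ofReal_mul_I θ).le h0 h1
  rw [norm_sub_rev, mul_comm (θ : ℂ), Complex.norm_exp_I_mul_ofReal_sub_one, norm_mul,
    Real.norm_eq_abs (Real.sin _), mul_comm Complex.I, Real.norm_of_nonneg (by norm_num)] at h
  have h2 := Real.mul_abs_le_abs_sin (x := θ / 2) (by
    rw [abs_div, abs_of_pos (by norm_num : (0 : ℝ) < 2)]; linarith)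
  rw [abs_div, abs_of_pos (by norm_num : (0 : ℝ) < 2)] at h2
  have : 2 / Real.pi * (|θ| / 2) = |θ| / Real.pi := by field_simp
  linarith

lemma lintegral_indicator_rpow {b m : ℝ} (hb : 1 < b) (hm : 0 < m) :
    ∫⁻ x, (Ici m).indicator (fun x => ENNReal.ofReal (x ^ (-b))) x =
      ENNReal.ofReal (m ^ (1 - b) / (b - 1)) := by
  rw [lintegral_indicator measurableSet_Ici, setLIntegral_congr Ioi_ae_eq_Ici.symm,
    ← ofReal_integral_eq_lintegral_ofReal (integrableOn_Ioi_rpow_of_lt (by linarith) hm),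
    integral_Ioi_rpow_of_lt (by linarith) hm]
  · congr 1
    rw [show -b + 1 = -(b - 1) by ring, show 1 - b = -(b - 1) by ring, neg_div_neg_eq]
  · refine (ae_restrict_iff' measurableSet_Ioi).2 (Filter.Eventually.of_forall fun x hx => ?_)
    exact Real.rpow_nonneg (hm.trans hx).le _

/-- The circular means of `|1-z|^{-b}`, `b > 1`. -/
lemma lintegral_circle_rpow_le {b : ℝ} (hb : 1 < b) {S : Set ℝ} (hS : MeasurableSet S)
    (hS' : S ⊆ Ioc (-Real.pi) (2 * Real.pi)) :
    ∃ C : ℝ, 0 ≤ C ∧ ∀ r : ℝ, 0 ≤ r → r < 1 →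
      ∫⁻ θ in S, ENNReal.ofReal (‖1 - r * Complex.exp (θ * Complex.I)‖ ^ (-b)) ≤
        ENNReal.ofReal (C * (1 - r) ^ (1 - b)) := by
  have hπ := Real.pi_pos
  refine ⟨4 * ((2 * Real.pi) ^ b * (Real.pi ^ (1 - b) / (b - 1))),
    mul_nonneg (by norm_num) (mul_nonneg (by positivity) (div_nonneg (by positivity) (by linarith))),
    fun r h0 h1 => ?_⟩
  have hr : 0 < 1 - r := by linarith
  set m := Real.pi * (1 - r) with hm
  have hm0 : 0 < m := by positivity
  set c := ENNReal.ofReal ((2 * Real.pi) ^ b) with hc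
  set G : ℝ → ℝ≥0∞ := (Ici m).indicator (fun x => ENNReal.ofReal (x ^ (-b))) with hG
  have hGm : Measurable G := Measurable.indicator (by fun_prop) measurableSet_Ici
  -- The average of the lower bounds `1-r` and `|θ|/π` is `(m+|θ|)/(2π)`. Summing `G` over `m+θ` and
  -- `m-θ` removes the absolute value.
  have hpt : ∀ θ : ℝ, |θ| ≤ Real.pi →
      ENNReal.ofReal (‖1 - r * Complex.exp (θ * Complex.I)‖ ^ (-b)) ≤
        c * (G (m + θ) + G (m - θ)) := by
    intro θ hθ
    have h2 := abs_div_pi_le_norm_one_sub_exp h0 h1.le hθ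
    have h3 := norm_sub_norm_le (1 : ℂ) (r * Complex.exp (θ * Complex.I))
    rw [norm_one, norm_mul, Complex.norm_real, Real.norm_of_nonneg h0,
      Complex.norm_exp_ofReal_mul_I, mul_one] at h3
    have h4 : (2 * Real.pi)⁻¹ * (m + |θ|) ≤ ‖1 - r * Complex.exp (θ * Complex.I)‖ := by
      have : (2 * Real.pi)⁻¹ * (m + |θ|) = ((1 - r) + |θ| / Real.pi) / 2 := by
        rw [hm]; field_simp
      linarith
    have h5 : 0 < m + |θ| := by positivity
    have h6 : ENNReal.ofReal (‖1 - r * Complex.exp (θ * Complex.I)‖ ^ (-b)) ≤ c * G (m + |θ|) := by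
      rw [hG, indicator_of_mem (by simp), hc, ← ENNReal.ofReal_mul (by positivity)]
      refine ENNReal.ofReal_le_ofReal ?_
      refine (Real.rpow_le_rpow_of_nonpos (by positivity) h4 (by linarith)).trans (le_of_eq ?_)
      rw [Real.mul_rpow (by positivity) h5.le, Real.inv_rpow (by positivity),
        Real.rpow_neg (by positivity), inv_inv]
    refine h6.trans (mul_le_mul_right ?_ _)
    rcases le_total 0 θ with h | h
    · rw [abs_of_nonneg h]; exact le_self_add
    · rw [abs_of_nonpos h, ← sub_eq_add_neg]; exact le_add_self
  -- Angles beyond `π` are shifted by `2π`, so both `(-π,π)` and `(0,2π]` are covered. The four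
  -- resulting integrals over `ℝ` coincide by translation and reflection.
  have hpt2 : ∀ θ ∈ S, ENNReal.ofReal (‖1 - r * Complex.exp (θ * Complex.I)‖ ^ (-b)) ≤
      c * ((G (m + θ) + G (m - θ)) + (G ((m - 2 * Real.pi) + θ) + G ((m + 2 * Real.pi) - θ))) := by
    intro θ hθ
    have hθ' := hS' hθ
    rcases le_or_gt θ Real.pi with h | h
    · refine (hpt θ (abs_le.2 ⟨hθ'.1.le, h⟩)).trans (mul_le_mul_right le_self_add _)
    · have := hpt (θ - 2 * Real.pi) (abs_le.2 ⟨by linarith, by linarith [hθ'.2]⟩)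
      rw [show (((θ - 2 * Real.pi : ℝ) : ℂ)) * Complex.I = θ * Complex.I - 2 * Real.pi * Complex.I by
        push_cast; ring, Complex.exp_periodic.sub_eq,
        show m + (θ - 2 * Real.pi) = m - 2 * Real.pi + θ by ring,
        show m - (θ - 2 * Real.pi) = m + 2 * Real.pi - θ by ring] at this
      exact this.trans (mul_le_mul_right le_add_self _)
  calc _ ≤ ∫⁻ θ in S, c * ((G (m + θ) + G (m - θ)) +
          (G ((m - 2 * Real.pi) + θ) + G ((m + 2 * Real.pi) - θ))) :=
        setLIntegral_mono' hS hpt2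
    _ ≤ ∫⁻ θ, c * ((G (m + θ) + G (m - θ)) +
          (G ((m - 2 * Real.pi) + θ) + G ((m + 2 * Real.pi) - θ))) := setLIntegral_le_lintegral _ _
    _ = c * (4 * ∫⁻ x, G x) := by
        rw [lintegral_const_mul' _ _ ENNReal.ofReal_ne_top, lintegral_add_left (by fun_prop),
          lintegral_add_left (by fun_prop), lintegral_add_left (by fun_prop),
          lintegral_add_left_eq_self, lintegral_sub_left_eq_self, lintegral_add_left_eq_self,
          lintegral_sub_left_eq_self]
        ring
    _ = _ := by
        have hb1 : 0 ≤ Real.pi ^ (1 - b) / (b - 1) := div_nonneg (by positivity) (by linarith)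
        rw [hG, lintegral_indicator_rpow hb hm0, hc, hm, Real.mul_rpow hπ.le hr.le,
          show (4 : ℝ≥0∞) = ENNReal.ofReal 4 by norm_num, ← ENNReal.ofReal_mul (by norm_num),
          ← ENNReal.ofReal_mul (by positivity)]
        congr 1
        ring

/-- A pointwise growth condition for the derivative that implies membership in `Λ^s_{1/s}`. -/
lemma mem_meanLipschitz_of_norm_deriv_le {s a K : ℝ} (hs : 1 < s) (ha : 1 < a * s)
    (hK : 0 ≤ K) {g : HolDisc}
    (hg : ∀ z : ℂ, ‖z‖ < 1 → ‖deriv g.1 z‖ ≤ K * (‖1 - z‖ ^ (-a) * (1 - ‖z‖) ^ (a - 1))) :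
    g ∈ MeanLipschitz s (1 / s) := by
  have hs0 : 0 < s := by linarith
  obtain ⟨C, hC0, hC⟩ := lintegral_circle_rpow_le ha (S := Ioc 0 (2 * Real.pi)) measurableSet_Ioc
    (Ioc_subset_Ioc_left (by linarith [Real.pi_pos]))
  set D := (ENNReal.ofReal (2 * Real.pi))⁻¹ with hD
  have hDt : D ≠ ∞ := by simp [hD, Real.pi_pos]
  suffices h : ∀ r ∈ Ioo (0 : ℝ) 1, ENNReal.ofReal ((1 - r) ^ (1 - 1 / s)) *
      integralMean s r (deriv g.1) ≤ (D * ENNReal.ofReal (K ^ s * C)) ^ (1 / s) by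
    refine ENNReal.add_lt_top.2 ⟨enorm_lt_top, (iSup₂_le h).trans_lt ?_⟩
    exact ENNReal.rpow_lt_top_of_nonneg (by positivity)
      (ENNReal.mul_ne_top hDt ENNReal.ofReal_ne_top)
  intro r hr
  have hr1 : 0 < 1 - r := by linarith [hr.2]
  have h1 : ∫⁻ θ in Ioc (0 : ℝ) (2 * Real.pi),
      ‖deriv g.1 (r * Complex.exp (θ * Complex.I))‖ₑ ^ s ≤
      ENNReal.ofReal (K ^ s * C * (1 - r) ^ (1 - s)) := by
    calc _ ≤ ∫⁻ θ in Ioc (0 : ℝ) (2 * Real.pi), ENNReal.ofReal ((K * (1 - r) ^ (a - 1)) ^ s) *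
          ENNReal.ofReal (‖1 - r * Complex.exp (θ * Complex.I)‖ ^ (-(a * s))) := by
          refine lintegral_mono fun θ => ?_
          have hn : ‖(r : ℂ) * Complex.exp (θ * Complex.I)‖ = r := by
            rw [norm_mul, Complex.norm_real, Real.norm_of_nonneg hr.1.le,
              Complex.norm_exp_ofReal_mul_I, mul_one]
          have h := hg (r * Complex.exp (θ * Complex.I)) (by rw [hn]; exact hr.2)
          rw [hn] at h
          rw [← ofReal_norm, ENNReal.ofReal_rpow_of_nonneg (norm_nonneg _) hs0.le,
            ← ENNReal.ofReal_mul (by positivity)]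
          refine ENNReal.ofReal_le_ofReal
            ((Real.rpow_le_rpow (norm_nonneg _) h hs0.le).trans (le_of_eq ?_))
          rw [mul_left_comm, mul_comm, Real.mul_rpow (by positivity) (by positivity),
            ← Real.rpow_mul (norm_nonneg _), neg_mul]
      _ ≤ ENNReal.ofReal ((K * (1 - r) ^ (a - 1)) ^ s) *
          ENNReal.ofReal (C * (1 - r) ^ (1 - a * s)) := by
          rw [lintegral_const_mul' _ _ ENNReal.ofReal_ne_top]
          exact mul_le_mul_right (hC r hr.1.le hr.2) _
      _ = _ := by
          rw [← ENNReal.ofReal_mul (by positivity), Real.mul_rpow hK (by positivity),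
            -- The exponent `a` cancels: only `(1-r)^{1-s}` remains, whose `s`-th root is exactly
            -- the growth allowed in `Λ^s_{1/s}`.
            ← Real.rpow_mul hr1.le, show 1 - s = (a - 1) * s + (1 - a * s) by ring,
            Real.rpow_add hr1]
          congr 1
          ring
  calc _ ≤ ENNReal.ofReal ((1 - r) ^ (1 - 1 / s)) *
        (D * ENNReal.ofReal (K ^ s * C * (1 - r) ^ (1 - s))) ^ (1 / s) := by
        rw [integralMean]
        gcongr
    _ = _ := by
        rw [ENNReal.ofReal_mul (by positivity), ← mul_assoc D,
          ENNReal.mul_rpow_of_nonneg _ (ENNReal.ofReal ((1 - r) ^ (1 - s))) (by positivity),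
          ENNReal.ofReal_rpow_of_nonneg (by positivity) (by positivity), mul_left_comm,
          ← ENNReal.ofReal_mul (by positivity), ← Real.rpow_mul hr1.le, ← Real.rpow_add hr1,
          show 1 - 1 / s + (1 - s) * (1 / s) = 0 by field_simp; ring, Real.rpow_zero,
          ENNReal.ofReal_one, mul_one]

/-! ### Pointwise bound for the derivative of the image -/

/-- For a logarithmic Carleson measure the derivative of `C_μ f` is dominated by
`|1-z|^{-a} (1-|z|)^{a-1}`, uniformly on the unit ball of `B_p`. -/
lemma norm_deriv_cesaroLike_le {p q a : ℝ} (hpq : p.HolderConjugate q) (ha0 : 0 ≤ a) (ha1 : a < 1)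
    {μ : Measure (Ico (0 : ℝ) 1)} [IsFiniteMeasure μ] (hμ : IsLogCarleson (1 / q) 1 μ) :
    ∃ K : ℝ, 0 ≤ K ∧ ∀ f ∈ Besov p, ∀ z : ℂ, ‖z‖ < 1 → ‖deriv (cesaroLike μ f).1 z‖ ≤
      K * (besovNorm p f).toReal * (‖1 - z‖ ^ (-a) * (1 - ‖z‖) ^ (a - 1)) := by
  have hq0 : 0 < q := hpq.symm.pos
  obtain ⟨C₁, hC₁, h₁⟩ := norm_deriv_le_of_besov hpq.lt
  obtain ⟨C₂, hC₂, h₂⟩ := norm_le_of_besov hpq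
  obtain ⟨K, hK0, hK⟩ := integral_logWeight_le (β := 1 / q) (by positivity) ha1 hμ
  refine ⟨(C₁ + C₂) * 2 ^ a * K, by positivity, fun f hf z hz => ?_⟩
  set N := (besovNorm p f).toReal with hN
  have hN0 : 0 ≤ N := ENNReal.toReal_nonneg
  obtain ⟨hint, heq⟩ := deriv_cesaroLike_eq_integral μ f hz
  set ψ : ℝ → ℝ := fun x => Real.log (Real.exp 1 / (1 - x)) ^ (1 / q) * (1 - x) ^ (a - 2) with hψ
  have hz1 : 0 < 1 - ‖z‖ := by linarith
  have hz1' : 0 < ‖1 - z‖ := norm_pos_iff.2 (one_sub_ne_zero_of_norm_lt_one hz)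
  have hψm : Measurable ψ := by fun_prop
  have hψint : Integrable (fun t : Ico (0 : ℝ) 1 => ψ (min (t : ℝ) ‖z‖)) μ := by
    refine Integrable.of_bound (C := ψ ‖z‖) (hψm.comp
      (by fun_prop : Measurable fun t : Ico (0 : ℝ) 1 => min (t : ℝ) ‖z‖)).aestronglyMeasurable
      (Filter.Eventually.of_forall fun t => ?_)
    have h3 : 0 ≤ min (t : ℝ) ‖z‖ := le_min t.2.1 (norm_nonneg z)
    have h4 := one_le_log_exp_one_div h3 (min_lt_of_right_lt hz)
    rw [Real.norm_of_nonneg]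
    · exact logWeight_mono (by positivity) (by linarith) h3 (min_le_right _ _) hz
    · exact mul_nonneg (Real.rpow_nonneg (by linarith) _)
        (Real.rpow_nonneg (by linarith [min_le_right (t : ℝ) ‖z‖]) _)
  have hpt : ∀ t : Ico (0 : ℝ) 1, ‖deriv (cesaroKernel f.1) ((t : ℝ) * z) * (t : ℝ)‖ ≤
      (C₁ + C₂) * N * (2 ^ a * ‖1 - z‖ ^ (-a)) * ψ (min (t : ℝ) ‖z‖) := by
    intro t
    have htz := norm_mul_lt_one hz t
    have ht0 := t.2.1
    have ht1 := t.2.2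
    set w : ℂ := (t : ℝ) * z with hw
    set ρ := ‖w‖ with hρ
    have hρ0 : 0 ≤ ρ := norm_nonneg w
    have hρt : ρ = t * ‖z‖ := by
      rw [hρ, hw, norm_mul, Complex.norm_real, Real.norm_of_nonneg ht0]
    have hρ1 : 0 < 1 - ρ := by linarith
    have hw1 : 1 - ρ ≤ ‖1 - w‖ := by
      have := norm_sub_norm_le (1 : ℂ) w
      rwa [norm_one] at this
    have hw2 : ‖1 - z‖ / 2 ≤ ‖1 - w‖ := by
      have := norm_one_sub_le_two_mul hz.le ht0 ht1.le
      linarith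
    have hw0 : 0 < ‖1 - w‖ := by linarith
    set ℓ := Real.log (Real.exp 1 / (1 - ρ)) ^ (1 / q) with hℓ
    have hL1 := one_le_log_exp_one_div hρ0 htz
    have hℓ1 : 1 ≤ ℓ := Real.one_le_rpow hL1 (by positivity)
    have hd : ‖deriv (cesaroKernel f.1) w‖ ≤ (C₁ + C₂) * N * ℓ * ((1 - ρ)⁻¹ * ‖1 - w‖⁻¹) := by
      rw [(hasDerivAt_cesaroKernel f htz).deriv]
      calc _ ≤ ‖deriv f.1 w‖ * ‖1 - w‖⁻¹ + ‖f.1 w‖ * (‖1 - w‖⁻¹ * ‖1 - w‖⁻¹) := by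
            refine (norm_add_le _ _).trans (le_of_eq ?_)
            rw [norm_div, norm_div, norm_pow]
            field_simp
        _ ≤ (C₁ * N / (1 - ρ) * ℓ) * ‖1 - w‖⁻¹ + (C₂ * N * ℓ) * ((1 - ρ)⁻¹ * ‖1 - w‖⁻¹) := by
            have e1 := h₁ f hf w htz
            have e2 := h₂ f hf w htz
            -- Since `ℓ ≥ 1`, the `f'` term can carry the same logarithm as the `f` term.
            have e3 : C₁ * N / (1 - ρ) ≤ C₁ * N / (1 - ρ) * ℓ :=
              le_mul_of_one_le_right (by positivity) hℓ1
            gcongr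
            exact e1.trans e3
        _ = _ := by
            field_simp
    -- The power `-a` keeps the distance from `z` to the point 1, needed for the circular means; the
    -- power `a-1` goes into the radial weight.
    have hinv : ‖1 - w‖⁻¹ ≤ 2 ^ a * ‖1 - z‖ ^ (-a) * (1 - ρ) ^ (a - 1) := by
      calc ‖1 - w‖⁻¹ = ‖1 - w‖ ^ (-a) * ‖1 - w‖ ^ (a - 1) := by
            rw [← Real.rpow_add hw0, show -a + (a - 1) = -1 by ring, Real.rpow_neg_one]
        _ ≤ (‖1 - z‖ / 2) ^ (-a) * (1 - ρ) ^ (a - 1) := by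
            exact mul_le_mul (Real.rpow_le_rpow_of_nonpos (by positivity) hw2 (by linarith))
              (Real.rpow_le_rpow_of_nonpos hρ1 hw1 (by linarith)) (by positivity) (by positivity)
        _ = _ := by
            rw [Real.div_rpow hz1'.le (by norm_num), Real.rpow_neg (by norm_num : (0 : ℝ) ≤ 2)]
            field_simp
    -- Here `ρ = t|z|` lies below both `t` and `|z|`, which produces the truncated weight.
    have hψρ : ψ ρ ≤ ψ (min (t : ℝ) ‖z‖) := by
      refine logWeight_mono (by positivity) (by linarith) hρ0 ?_ (min_lt_of_right_lt hz)
      rw [hρt]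
      exact le_min (mul_le_of_le_one_right ht0 hz.le)
        (mul_le_of_le_one_left (norm_nonneg z) ht1.le)
    calc _ ≤ ‖deriv (cesaroKernel f.1) w‖ := by
          rw [norm_mul, Complex.norm_real, Real.norm_of_nonneg ht0]
          exact mul_le_of_le_one_right (norm_nonneg _) ht1.le
      _ ≤ (C₁ + C₂) * N * ℓ * ((1 - ρ)⁻¹ * (2 ^ a * ‖1 - z‖ ^ (-a) * (1 - ρ) ^ (a - 1))) := by
          refine hd.trans ?_
          gcongr
      _ = (C₁ + C₂) * N * (2 ^ a * ‖1 - z‖ ^ (-a)) * ψ ρ := by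
          simp only [hψ]
          rw [show a - 1 = a - 2 + 1 by ring, Real.rpow_add_one hρ1.ne']
          field_simp
          rfl
      _ ≤ _ := by gcongr
  rw [heq]
  calc _ ≤ ∫ t : Ico (0 : ℝ) 1,
        (C₁ + C₂) * N * (2 ^ a * ‖1 - z‖ ^ (-a)) * ψ (min (t : ℝ) ‖z‖) ∂μ :=
        norm_integral_le_of_norm_le (hψint.const_mul _) (Filter.Eventually.of_forall hpt)
    _ = (C₁ + C₂) * N * (2 ^ a * ‖1 - z‖ ^ (-a)) * ∫ t : Ico (0 : ℝ) 1, ψ (min (t : ℝ) ‖z‖) ∂μ :=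
        integral_const_mul _ _
    _ ≤ (C₁ + C₂) * N * (2 ^ a * ‖1 - z‖ ^ (-a)) * (K * (1 - ‖z‖) ^ (a - 1)) := by
        gcongr
        exact hK ‖z‖ (norm_nonneg z) hz
    _ = _ := by ring

/-! ### Norm estimates from inclusions of spaces -/

lemma norm_le_of_norm_deriv_le {g : HolDisc} {W : ℂ → ℝ} {r B : ℝ} (hr1 : r < 1)
    (hB : ∀ z : ℂ, ‖z‖ ≤ r → W z ≤ B) (h0 : ‖g.1 0‖ ≤ 1)
    (hg : ∀ z : ℂ, ‖z‖ < 1 → ‖deriv g.1 z‖ ≤ W z) {z : ℂ} (hz : ‖z‖ ≤ r) :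
    ‖g.1 z‖ ≤ 1 + B := by
  have hr0 : 0 ≤ r := (norm_nonneg z).trans hz
  have h := Convex.norm_image_sub_le_of_norm_deriv_le (f := g.1) (s := closedBall 0 r) (C := B)
    (x := 0) (y := z)
    (fun w hw => holDisc_differentiableAt g ((mem_closedBall_zero_iff.1 hw).trans_lt hr1))
    (fun w hw => (hg w ((mem_closedBall_zero_iff.1 hw).trans_lt hr1)).trans
      (hB w (mem_closedBall_zero_iff.1 hw)))
    (convex_closedBall 0 r) (by simpa using hr0) (by simpa using hz)
  have hB0 : 0 ≤ B := (norm_nonneg _).trans ((hg z (hz.trans_lt hr1)).trans (hB z hz))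
  rw [sub_zero] at h
  have h2 := norm_le_insert' (g.1 z) (g.1 0)
  nlinarith [norm_nonneg z]

/-- If `X` contains all functions whose derivative is dominated by a multiple of `W`, then the
inclusion is bounded: the closed graph theorem for the induced operator from `ℓ¹`. -/
lemma exists_norm_le_of_dominated {X : Type*} [NormedAddCommGroup X] [NormedSpace ℂ X]
    {ι : X →ₗ[ℂ] HolDisc} (hX : IsAnalyticBanachSpace ι) {W : ℂ → ℝ}
    (hW : ∀ r < 1, ∃ B : ℝ, ∀ z : ℂ, ‖z‖ ≤ r → W z ≤ B)
    (hmem : ∀ K : ℝ, 0 ≤ K → ∀ g : HolDisc, (∀ z : ℂ, ‖z‖ < 1 → ‖deriv g.1 z‖ ≤ K * W z) →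
      g ∈ Set.range ι) :
    ∃ C : ℝ, 0 ≤ C ∧ ∀ x : X, ‖(ι x).1 0‖ ≤ 1 →
      (∀ z : ℂ, ‖z‖ < 1 → ‖deriv (ι x).1 z‖ ≤ W z) → ‖x‖ ≤ C := by
  have := hX.complete
  -- The unit ball of dominated functions serves as an index set. The synthesis map `c ↦ ∑ c_u u`
  -- lives on the complete space `ℓ¹(U)`, so no completeness of the space of dominated functions is
  -- needed.
  let U : Type _ := {g : HolDisc // ‖g.1 0‖ ≤ 1 ∧ ∀ z : ℂ, ‖z‖ < 1 → ‖deriv g.1 z‖ ≤ W z}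
  have hbd : ∀ r < 1, ∃ B : ℝ, ∀ g : U, ∀ z : ℂ, ‖z‖ ≤ r → ‖g.1.1 z‖ ≤ B := by
    intro r hr
    obtain ⟨B, hB⟩ := hW r hr
    exact ⟨1 + B, fun g z hz => norm_le_of_norm_deriv_le hr hB g.2.1 g.2.2 hz⟩
  have hsum : ∀ c : lp (fun _ : U => ℂ) 1, Summable fun u => ‖c u‖ := fun c => by
    simpa using (lp.memℓp c).summable (by simp)
  have hnorm : ∀ c : lp (fun _ : U => ℂ) 1, ∑' u, ‖c u‖ = ‖c‖ := fun c => by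
    simpa using (lp.norm_eq_tsum_rpow (p := 1) (by simp) c).symm
  have hsm : ∀ (c : lp (fun _ : U => ℂ) 1) (z : ℂ), Summable fun u : U => c u * u.1.1 z := by
    intro c z
    by_cases hz : ‖z‖ < 1
    · obtain ⟨B, hB⟩ := hbd ‖z‖ hz
      refine Summable.of_norm_bounded ((hsum c).mul_right B) fun u => ?_
      rw [norm_mul]
      exact mul_le_mul_of_nonneg_left (hB u z le_rfl) (norm_nonneg _)
    · have : (fun u : U => c u * u.1.1 z) = fun _ => 0 := by
        funext u
        rw [u.1.2.2 z (by simpa using hz), mul_zero]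
      rw [this]; exact summable_zero
  have hterm : ∀ (c : lp (fun _ : U => ℂ) 1) (u : U), DifferentiableOn ℂ (fun z => c u * u.1.1 z) (ball 0 1) :=
    fun c u => u.1.2.1.const_mul _
  have hdom : ∀ (c : lp (fun _ : U => ℂ) 1) (z : ℂ), ‖z‖ < 1 → ∃ r, ‖z‖ < r ∧ r < 1 ∧ ∃ B : ℝ, ∀ (u : U) (w : ℂ),
      w ∈ ball (0 : ℂ) r → ‖c u * u.1.1 w‖ ≤ ‖c u‖ * B := by
    intro c z hz
    obtain ⟨r, hzr, hr1⟩ := exists_between hz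
    obtain ⟨B, hB⟩ := hbd r hr1
    refine ⟨r, hzr, hr1, B, fun u w hw => ?_⟩
    rw [norm_mul]
    exact mul_le_mul_of_nonneg_left (hB u w (mem_ball_zero_iff.1 hw).le) (norm_nonneg _)
  have hhol : ∀ c : lp (fun _ : U => ℂ) 1, (fun z => ∑' u : U, c u * u.1.1 z) ∈ HolDisc := by
    intro c
    refine ⟨fun z hz => ?_, fun z hz => ?_⟩
    · obtain ⟨r, hzr, hr1, B, hB⟩ := hdom c z (by simpa using hz)
      have := Complex.differentiableOn_tsum_of_summable_norm ((hsum c).mul_right B)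
        (fun u => (hterm c u).mono (ball_subset_ball hr1.le)) isOpen_ball hB
      exact (this.differentiableAt (isOpen_ball.mem_nhds (by simpa using hzr))).differentiableWithinAt
    · exact (tsum_congr fun u : U => by rw [u.1.2.2 z hz, mul_zero]).trans tsum_zero
  let S : lp (fun _ : U => ℂ) 1 →ₗ[ℂ] HolDisc :=
    { toFun := fun c => ⟨fun z => ∑' u : U, c u * u.1.1 z, hhol c⟩
      map_add' := fun c d => by
        ext z
        exact (tsum_congr fun u => add_mul (c u) (d u) (u.1.1 z)).trans
          ((hsm c z).tsum_add (hsm d z))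
      map_smul' := fun a c => by
        ext z
        exact (tsum_congr fun u => mul_assoc a (c u) (u.1.1 z)).trans tsum_mul_left }
  have hSap : ∀ (c : lp (fun _ : U => ℂ) 1) (z : ℂ), (S c).1 z = ∑' u : U, c u * u.1.1 z := fun _ _ => rfl
  -- Termwise differentiation shows that `S c` is dominated with constant `‖c‖₁`.
  have hSr : ∀ c : lp (fun _ : U => ℂ) 1, S c ∈ LinearMap.range ι := by
    intro c
    refine LinearMap.mem_range.2 (hmem ‖c‖ (norm_nonneg c) (S c) fun z hz => ?_)
    obtain ⟨r, hzr, hr1, B, hB⟩ := hdom c z hz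
    have hd := Complex.hasSum_deriv_of_summable_norm ((hsum c).mul_right B)
        (fun u => (hterm c u).mono (ball_subset_ball hr1.le)) isOpen_ball hB
        (show z ∈ ball (0 : ℂ) r by simpa using hzr)
    have he : deriv (S c).1 z = ∑' u : U, deriv (fun z => c u * u.1.1 z) z := hd.tsum_eq.symm
    rw [he, ← hnorm c, ← tsum_mul_right]
    refine tsum_of_norm_bounded ((hsum c).mul_right (W z)).hasSum fun u => ?_
    rw [deriv_const_mul _ (holDisc_differentiableAt u.1 hz), norm_mul]
    exact mul_le_mul_of_nonneg_left (u.2.2 z hz) (norm_nonneg _)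
  let T : lp (fun _ : U => ℂ) 1 →ₗ[ℂ] X := (LinearEquiv.ofInjective ι hX.injective).symm.toLinearMap ∘ₗ
    S.codRestrict (LinearMap.range ι) hSr
  have hT : ∀ c, ι (T c) = S c := fun c => by
    have := (LinearEquiv.ofInjective ι hX.injective).apply_symm_apply
      (S.codRestrict (LinearMap.range ι) hSr c)
    exact congrArg Subtype.val this
  have hScont : ∀ z : ℂ, ‖z‖ < 1 → Continuous fun c : lp (fun _ : U => ℂ) 1 => (S c).1 z := by
    intro z hz
    obtain ⟨B, hB⟩ := hbd ‖z‖ hz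
    let ev : lp (fun _ : U => ℂ) 1 →ₗ[ℂ] ℂ := (LinearMap.proj z : (ℂ → ℂ) →ₗ[ℂ] ℂ) ∘ₗ HolDisc.subtype ∘ₗ S
    refine (ev.mkContinuous B fun c => ?_).continuous
    change ‖∑' u : U, c u * u.1.1 z‖ ≤ B * ‖c‖
    rw [mul_comm, ← hnorm c, ← tsum_mul_right]
    refine tsum_of_norm_bounded ((hsum c).mul_right B).hasSum fun u => ?_
    rw [norm_mul]
    exact mul_le_mul_of_nonneg_left (hB u z le_rfl) (norm_nonneg _)
  -- Closed graph: convergence in `ℓ¹(U)` and convergence in `X` both imply pointwise convergence on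
  -- the disc, so the limits agree.
  have hTc : Continuous T := by
    refine T.continuous_of_seq_closed_graph fun c c₀ y hc hTc => ?_
    refine hX.injective (Subtype.ext (funext fun z => ?_))
    by_cases hz : z ∈ ball (0 : ℂ) 1
    · have h1 := ((hX.continuous_eval z hz).tendsto y).comp hTc
      have h2 := ((hScont z (by simpa using hz)).tendsto c₀).comp hc
      rw [hT]
      refine tendsto_nhds_unique h1 (h2.congr fun n => ?_)
      simp only [Function.comp_apply, hT]
    · rw [(ι y).2.2 z hz, (ι (T c₀)).2.2 z hz]
  let Tc : lp (fun _ : U => ℂ) 1 →L[ℂ] X := ⟨T, hTc⟩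
  refine ⟨‖Tc‖, norm_nonneg _, fun x hx0 hx => ?_⟩
  classical
  -- Each admissible `x` is the image of the unit vector supported at its own index, so `‖T‖` bounds
  -- it.
  let u : U := ⟨ι x, hx0, hx⟩
  have hs : S (lp.single 1 u 1) = ι x := by
    refine Subtype.ext (funext fun z => ?_)
    rw [hSap, tsum_eq_single u]
    · rw [lp.single_apply_self, one_mul]
    · intro v hv
      rw [lp.single_apply_ne _ _ _ hv, zero_mul]
  have hTx : T (lp.single 1 u 1) = x := hX.injective (by rw [hT, hs])
  have := Tc.le_opNorm (lp.single 1 u 1)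
  rw [lp.norm_single (by simp), norm_one, mul_one] at this
  change ‖T (lp.single 1 u 1)‖ ≤ _ at this
  rwa [hTx] at this

/-- The inclusion of `X` in the Bloch space is bounded. -/
lemma exists_norm_deriv_le_of_range_subset_bloch {X : Type*} [NormedAddCommGroup X]
    [NormedSpace ℂ X] {ι : X →ₗ[ℂ] HolDisc} (hX : IsAnalyticBanachSpace ι)
    (hXB : Set.range ι ⊆ Bloch) :
    ∃ C : ℝ, 0 ≤ C ∧ ∀ (x : X) (z : ℂ), ‖z‖ < 1 →
      (1 - ‖z‖ ^ 2) * ‖deriv (ι x).1 z‖ ≤ C * ‖x‖ := by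
  have := hX.complete
  let ev : ∀ z ∈ ball (0 : ℂ) 1, X →L[ℂ] ℂ := fun z hz =>
    ⟨(LinearMap.proj z : (ℂ → ℂ) →ₗ[ℂ] ℂ) ∘ₗ HolDisc.subtype ∘ₗ ι, hX.continuous_eval z hz⟩
  -- The functional `x ↦ (ι x)'(z)` is a pointwise limit of difference quotients of evaluations,
  -- hence continuous by Banach–Steinhaus.
  have hder : ∀ z : ℂ, ‖z‖ < 1 → ∃ D : X →L[ℂ] ℂ, ∀ x, D x = deriv (ι x).1 z := by
    intro z hz
    obtain ⟨δ, hδ0, hδ⟩ : ∃ δ : ℝ, 0 < δ ∧ ‖z‖ + δ < 1 := ⟨(1 - ‖z‖) / 2, by linarith, by linarith⟩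
    let h : ℕ → ℂ := fun n => (δ / (n + 1) : ℝ)
    have hh0 : ∀ n, h n ≠ 0 := fun n => by
      simp only [h, ne_eq, Complex.ofReal_eq_zero]
      positivity
    have hhn : ∀ n, z + h n ∈ ball (0 : ℂ) 1 := fun n => by
      rw [mem_ball_zero_iff]
      have h1 : ‖h n‖ ≤ δ := by
        simp only [h, Complex.norm_real]
        rw [Real.norm_of_nonneg (by positivity)]
        exact div_le_self hδ0.le (by linarith [(Nat.cast_nonneg n : (0 : ℝ) ≤ n)])
      linarith [norm_add_le z (h n)]
    have hz' : z ∈ ball (0 : ℂ) 1 := by simpa using hz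
    have hht : Filter.Tendsto h Filter.atTop (nhds 0) := by
      have h1 : Filter.Tendsto (fun n : ℕ => δ / (n + 1 : ℝ)) Filter.atTop (nhds 0) := by
        simpa [div_eq_mul_inv] using (tendsto_one_div_add_atTop_nhds_zero_nat (𝕜 := ℝ)).const_mul δ
      simpa [h, Function.comp_def] using (Complex.continuous_ofReal.tendsto 0).comp h1
    let q : ℕ → X →L[ℂ] ℂ := fun n => (h n)⁻¹ • (ev (z + h n) (hhn n) - ev z hz')
    have hq : Filter.Tendsto (fun n x => q n x) Filter.atTop
        (nhds fun x => deriv (ι x).1 z) := by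
      rw [tendsto_pi_nhds]
      intro x
      have h2 := (holDisc_differentiableAt (ι x) hz).hasDerivAt.tendsto_slope_zero
      exact h2.comp (tendsto_nhdsWithin_iff.2 ⟨hht, Filter.Eventually.of_forall hh0⟩)
    exact ⟨continuousLinearMapOfTendsto q hq, fun x => rfl⟩
  choose D hD using hder
  let Φ : ball (0 : ℂ) 1 → X →L[ℂ] ℂ := fun z =>
    ((1 - ‖(z : ℂ)‖ ^ 2 : ℝ) : ℂ) • D z (mem_ball_zero_iff.1 z.2)
  have hΦ : ∀ (z : ball (0 : ℂ) 1) (x : X),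
      ‖Φ z x‖ = (1 - ‖(z : ℂ)‖ ^ 2) * ‖deriv (ι x).1 z‖ := by
    intro z x
    have hz : ‖(z : ℂ)‖ < 1 := mem_ball_zero_iff.1 z.2
    have h1 : 0 ≤ 1 - ‖(z : ℂ)‖ ^ 2 := by nlinarith [norm_nonneg (z : ℂ)]
    simp only [Φ, smul_apply, norm_smul, hD, Complex.norm_real]
    rw [Real.norm_of_nonneg h1]
  -- The weighted derivative functionals are bounded at each `x` by its Bloch norm, hence uniformly.
  obtain ⟨C, hC⟩ := banach_steinhaus (g := Φ) fun x => by
    have hb : blochNorm (ι x) < ∞ := hXB ⟨x, rfl⟩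
    refine ⟨(blochNorm (ι x)).toReal, fun z => ?_⟩
    rw [hΦ, ← ENNReal.ofReal_le_iff_le_toReal hb.ne]
    have hz : ‖(z : ℂ)‖ < 1 := mem_ball_zero_iff.1 z.2
    have h1 : 0 ≤ 1 - ‖(z : ℂ)‖ ^ 2 := by nlinarith [norm_nonneg (z : ℂ)]
    rw [ENNReal.ofReal_mul h1, ofReal_norm, blochNorm]
    exact le_add_left (le_iSup₂ (f := fun (z : ℂ) (_ : z ∈ ball (0 : ℂ) 1) =>
      ENNReal.ofReal (1 - ‖z‖ ^ 2) * ‖deriv (ι x).1 z‖ₑ) (z : ℂ) z.2)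
  refine ⟨C, (norm_nonneg _).trans (hC ⟨0, by simp⟩), fun x z hz => ?_⟩
  rw [← hΦ ⟨z, by simpa using hz⟩]
  exact (Φ _).le_of_opNorm_le (hC _) x

/-! ### Logarithmic test functions -/

lemma setLIntegral_one_sub_rpow {β a : ℝ} (hβ : -1 < β) (ha : a ≤ 1) :
    ∫⁻ r in Ioo a 1, ENNReal.ofReal ((1 - r) ^ β) =
      ENNReal.ofReal ((1 - a) ^ (β + 1) / (β + 1)) := by
  have hint : IntervalIntegrable (fun r : ℝ => (1 - r) ^ β) volume a 1 := by
    simpa using (intervalIntegral.intervalIntegrable_rpow' (a := 1 - a) (b := 0) hβ).comp_sub_left 1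
  have hI : ∫ r in a..1, (1 - r) ^ β = (1 - a) ^ (β + 1) / (β + 1) := by
    rw [intervalIntegral.integral_comp_sub_left (fun x : ℝ => x ^ β) 1, integral_rpow (Or.inl hβ),
      sub_self, Real.zero_rpow (by linarith), sub_zero]
  rw [← hI, intervalIntegral.integral_of_le ha, integral_Ioc_eq_integral_Ioo,
    ofReal_integral_eq_lintegral_ofReal]
  · exact (intervalIntegrable_iff_integrableOn_Ioo_of_le ha).1 hint
  · refine (ae_restrict_iff' measurableSet_Ioo).2 (Filter.Eventually.of_forall fun x hx => ?_)
    exact Real.rpow_nonneg (by linarith [hx.2]) _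

/-- Split at `r = a`. Below it `1-ar ≥ 1-r` leaves `(1-r)⁻¹`, whose integral is the logarithm; above
it `1-ar ≥ 1-a` leaves a constant. -/
lemma lintegral_radial_le {p : ℝ} (hp : 1 < p) {a : ℝ} (h0 : 0 ≤ a) (h1 : a < 1) :
    ∫⁻ r in Ioo (0 : ℝ) 1, ENNReal.ofReal ((1 - r) ^ (p - 2) * (1 - a * r) ^ (1 - p)) ≤
      ENNReal.ofReal ((1 + 1 / (p - 1)) * Real.log (Real.exp 1 / (1 - a))) := by
  have ha : 0 < 1 - a := by linarith
  have hp1 : 0 < p - 1 := by linarith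
  have hL1 := one_le_log_exp_one_div h0 h1
  have hlog := Real.log_nonpos ha.le (by linarith)
  have e1 : ∫⁻ r in Ioo (0 : ℝ) a, ENNReal.ofReal ((1 - r) ^ (p - 2) * (1 - a * r) ^ (1 - p)) ≤
      ENNReal.ofReal (-Real.log (1 - a)) := by
    rw [← lintegral_inv_one_sub h0 h1]
    refine setLIntegral_mono' measurableSet_Ioo fun r hr => ENNReal.ofReal_le_ofReal ?_
    have hr1 : 0 < 1 - r := by linarith [hr.2]
    calc _ ≤ (1 - r) ^ (p - 2) * (1 - r) ^ (1 - p) := by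
          refine mul_le_mul_of_nonneg_left ?_ (by positivity)
          exact Real.rpow_le_rpow_of_nonpos hr1 (by nlinarith [hr.1]) (by linarith)
      _ = _ := by
          rw [← Real.rpow_add hr1, show p - 2 + (1 - p) = -1 by ring, Real.rpow_neg_one]
  have e2 : ∫⁻ r in Ioo a 1, ENNReal.ofReal ((1 - r) ^ (p - 2) * (1 - a * r) ^ (1 - p)) ≤
      ENNReal.ofReal (1 / (p - 1)) := by
    calc _ ≤ ∫⁻ r in Ioo a 1, ENNReal.ofReal ((1 - a) ^ (1 - p)) *
          ENNReal.ofReal ((1 - r) ^ (p - 2)) := by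
          refine setLIntegral_mono' measurableSet_Ioo fun r hr => ?_
          rw [← ENNReal.ofReal_mul (by positivity), mul_comm]
          have hr1 : 0 < 1 - r := by linarith [hr.2]
          refine ENNReal.ofReal_le_ofReal (mul_le_mul_of_nonneg_right ?_ (by positivity))
          exact Real.rpow_le_rpow_of_nonpos ha (by nlinarith [hr.1]) (by linarith)
      _ = _ := by
          rw [lintegral_const_mul' _ _ ENNReal.ofReal_ne_top,
            setLIntegral_one_sub_rpow (by linarith) h1.le, ← ENNReal.ofReal_mul (by positivity),
            show p - 2 + 1 = p - 1 by ring, ← mul_div_assoc, ← Real.rpow_add ha,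
            show 1 - p + (p - 1) = 0 by ring, Real.rpow_zero]
  have hsub : Ioo (0 : ℝ) 1 ⊆ Ioo 0 a ∪ ({a} ∪ Ioo a 1) := by
    intro x hx
    rcases lt_trichotomy x a with h | h | h
    · exact Or.inl ⟨hx.1, h⟩
    · exact Or.inr (Or.inl h)
    · exact Or.inr (Or.inr ⟨h, hx.2⟩)
  have e3 := (lintegral_mono_set (μ := volume) (f := fun r : ℝ =>
    ENNReal.ofReal ((1 - r) ^ (p - 2) * (1 - a * r) ^ (1 - p))) hsub).trans
    ((lintegral_union_le _ _ _).trans (add_le_add le_rfl (lintegral_union_le _ _ _)))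
  rw [setLIntegral_measure_zero {a} _ (by simp), zero_add] at e3
  refine e3.trans ((add_le_add e1 e2).trans ?_)
  rw [← ENNReal.ofReal_add (by linarith) (by positivity)]
  refine ENNReal.ofReal_le_ofReal ?_
  have h5 : 1 / (p - 1) ≤ 1 / (p - 1) * Real.log (Real.exp 1 / (1 - a)) :=
    le_mul_of_one_le_right (by positivity) hL1
  have h6 := log_exp_one_div h1
  linarith

lemma one_sub_mul_mem_slitPlane {a : ℝ} (h0 : 0 ≤ a) (h1 : a ≤ 1) {z : ℂ} (hz : ‖z‖ < 1) :
    1 - a * z ∈ Complex.slitPlane := by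
  have := Complex.mem_slitPlane_of_norm_lt_one (z := -(a * z)) (by
    rw [norm_neg, norm_mul, Complex.norm_real, Real.norm_of_nonneg h0]
    nlinarith [norm_nonneg z])
  rwa [← sub_eq_add_neg] at this

lemma hasDerivAt_logTest {a : ℝ} (h0 : 0 ≤ a) (h1 : a ≤ 1) (c : ℂ) {z : ℂ} (hz : ‖z‖ < 1) :
    HasDerivAt (fun w : ℂ => c - Complex.log (1 - a * w)) (a / (1 - a * z)) z := by
  have h := ((((hasDerivAt_id z).const_mul (a : ℂ)).const_sub 1).clog
    (one_sub_mul_mem_slitPlane h0 h1 hz)).const_sub c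
  simpa [neg_div] using h

/-- The test functions `c - log(1-az)`. -/
noncomputable def logTest (a : ℝ) (h0 : 0 ≤ a) (h1 : a ≤ 1) (c : ℂ) : HolDisc :=
  ⟨(ball (0 : ℂ) 1).indicator fun z => c - Complex.log (1 - a * z),
    DifferentiableOn.congr (fun _ hz => (hasDerivAt_logTest h0 h1 c
      (mem_ball_zero_iff.1 hz)).differentiableAt.differentiableWithinAt)
      fun _ hz => indicator_of_mem hz _, fun _ hz => indicator_of_notMem hz _⟩

lemma logTest_apply {a : ℝ} (h0 : 0 ≤ a) (h1 : a ≤ 1) (c : ℂ) {z : ℂ} (hz : ‖z‖ < 1) :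
    (logTest a h0 h1 c).1 z = c - Complex.log (1 - a * z) :=
  indicator_of_mem (s := ball (0 : ℂ) 1) (by simpa using hz) fun z => c - Complex.log (1 - a * z)

lemma deriv_logTest {a : ℝ} (h0 : 0 ≤ a) (h1 : a ≤ 1) (c : ℂ) {z : ℂ} (hz : ‖z‖ < 1) :
    deriv (logTest a h0 h1 c).1 z = a / (1 - a * z) := by
  rw [← (hasDerivAt_logTest h0 h1 c hz).deriv]
  refine Filter.EventuallyEq.deriv_eq (Filter.eventually_of_mem
    (isOpen_ball.mem_nhds (mem_ball_zero_iff.2 hz)) fun w hw => ?_)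
  exact logTest_apply h0 h1 c (mem_ball_zero_iff.1 hw)

/-- In polar coordinates the circular means of `|1-az|^{-p}` are of size `(1-ar)^{1-p}`, and the
radial integral then gives a single logarithm under the `p`-th root. -/
lemma besovNorm_logTest_le {p : ℝ} (hp : 1 < p) (c : ℂ) : ∃ C : ℝ, 0 ≤ C ∧
    ∀ (a : ℝ) (h0 : 0 ≤ a) (h1 : a < 1), besovNorm p (logTest a h0 h1.le c) ≤
      ENNReal.ofReal (C * Real.log (Real.exp 1 / (1 - a)) ^ (1 / p)) := by
  have hp0 : 0 < p := by linarith
  have hp1 : 0 < p - 1 := by linarith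
  obtain ⟨C₁, hC₁, h₁⟩ := lintegral_circle_rpow_le hp (S := Ioo (-Real.pi) Real.pi)
    measurableSet_Ioo (Ioo_subset_Ioc_self.trans (Ioc_subset_Ioc_right (by linarith [Real.pi_pos])))
  set D := 4 ^ |p - 2| * C₁ * (1 + 1 / (p - 1)) / Real.pi with hD
  have hD0 : 0 ≤ D := by positivity
  refine ⟨‖c‖ + D ^ (1 / p), by positivity, fun a h0 h1 => ?_⟩
  set f := logTest a h0 h1.le c with hf
  set L := Real.log (Real.exp 1 / (1 - a)) with hL
  have hL1 : 1 ≤ L := one_le_log_exp_one_div h0 h1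
  have hJ : ∫⁻ z in ball (0 : ℂ) 1,
      ‖deriv f.1 z‖ₑ ^ p * ENNReal.ofReal ((1 - ‖z‖ ^ 2) ^ (p - 2)) ≤
      ENNReal.ofReal (Real.pi * (D * L)) := by
    have hm : Measurable fun z : ℂ =>
        ‖deriv f.1 z‖ₑ ^ p * ENNReal.ofReal ((1 - ‖z‖ ^ 2) ^ (p - 2)) :=
      ((measurable_deriv f.1).enorm.pow_const p).mul (by fun_prop)
    rw [lintegral_ball_eq_polar 0 1 hm]
    calc _ ≤ ∫⁻ r in Ioo (0 : ℝ) 1, ENNReal.ofReal (4 ^ |p - 2| * C₁) *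
          ENNReal.ofReal ((1 - r) ^ (p - 2) * (1 - a * r) ^ (1 - p)) := by
          refine setLIntegral_mono' measurableSet_Ioo fun r hr => ?_
          have hr1 : 0 < 1 - r := by linarith [hr.2]
          have hr0 : 0 < r := hr.1
          have har0 : 0 ≤ a * r := by positivity
          have har1 : a * r < 1 := by nlinarith
          have hw : (1 - r ^ 2) ^ (p - 2) ≤ 4 ^ |p - 2| * (1 - r) ^ (p - 2) :=
            Real.rpow_le_four_rpow_abs_mul _ hr1 (by nlinarith) (by nlinarith) (by nlinarith)
          calc _ ≤ 1 * ∫⁻ θ in Ioo (-Real.pi) Real.pi,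
                ENNReal.ofReal (4 ^ |p - 2| * (1 - r) ^ (p - 2)) * ENNReal.ofReal
                (‖1 - (a * r : ℝ) * Complex.exp (θ * Complex.I)‖ ^ (-p)) := by
                refine mul_le_mul' (by simpa using hr.2.le) (lintegral_mono fun θ => ?_)
                have hn : ‖(r : ℂ) * Complex.exp (θ * Complex.I)‖ = r := by
                  rw [norm_mul, Complex.norm_real, Real.norm_of_nonneg hr.1.le,
                    Complex.norm_exp_ofReal_mul_I, mul_one]
                simp only [zero_add, hn]
                rw [hf, deriv_logTest h0 h1.le c (by rw [hn]; exact hr.2), mul_comm]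
                refine mul_le_mul' (ENNReal.ofReal_le_ofReal hw) ?_
                rw [← ofReal_norm, ENNReal.ofReal_rpow_of_nonneg (norm_nonneg _) hp0.le]
                refine ENNReal.ofReal_le_ofReal ?_
                rw [norm_div, Complex.norm_real, Real.norm_of_nonneg h0, Complex.ofReal_mul,
                  mul_assoc, Real.rpow_neg (norm_nonneg _), ← Real.inv_rpow (norm_nonneg _)]
                refine Real.rpow_le_rpow (by positivity) ?_ hp0.le
                rw [div_eq_mul_inv]
                exact mul_le_of_le_one_left (by positivity) h1.le
            _ ≤ ENNReal.ofReal (4 ^ |p - 2| * (1 - r) ^ (p - 2)) *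
                ENNReal.ofReal (C₁ * (1 - a * r) ^ (1 - p)) := by
                rw [one_mul, lintegral_const_mul' _ _ ENNReal.ofReal_ne_top]
                exact mul_le_mul_right (h₁ (a * r) har0 har1) _
            _ = _ := by
                rw [← ENNReal.ofReal_mul (by positivity), ← ENNReal.ofReal_mul (by positivity)]
                congr 1
                ring
      _ ≤ ENNReal.ofReal (4 ^ |p - 2| * C₁) * ENNReal.ofReal ((1 + 1 / (p - 1)) * L) := by
          rw [lintegral_const_mul' _ _ ENNReal.ofReal_ne_top]
          exact mul_le_mul_right (lintegral_radial_le hp h0 h1) _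
      _ = _ := by
          rw [← ENNReal.ofReal_mul (by positivity), hD]
          congr 1
          field_simp
  have hf0 : f.1 0 = c := by
    rw [hf, logTest_apply h0 h1.le c (by simp)]
    simp
  have hJ' : (∫⁻ z, ‖deriv f.1 z‖ₑ ^ p * ENNReal.ofReal ((1 - ‖z‖ ^ 2) ^ (p - 2)) ∂diskArea)
      ≤ ENNReal.ofReal (D * L) := by
    rw [diskArea, lintegral_smul_measure, smul_eq_mul]
    refine (mul_le_mul_right hJ _).trans (le_of_eq ?_)
    rw [ENNReal.ofReal_mul Real.pi_pos.le, ← mul_assoc, ENNReal.inv_mul_cancel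
      (by simp [Real.pi_pos]) ENNReal.ofReal_ne_top, one_mul]
  have hLp : 1 ≤ L ^ (1 / p) := Real.one_le_rpow hL1 (by positivity)
  calc besovNorm p f ≤ ENNReal.ofReal ‖c‖ + ENNReal.ofReal (D * L) ^ (1 / p) := by
        rw [besovNorm, hf0, ofReal_norm]
        gcongr
    _ = ENNReal.ofReal (‖c‖ + D ^ (1 / p) * L ^ (1 / p)) := by
        rw [ENNReal.ofReal_rpow_of_nonneg (by positivity) (by positivity),
          ← ENNReal.ofReal_add (norm_nonneg _) (by positivity), Real.mul_rpow hD0 (by positivity)]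
    _ ≤ _ := by
        refine ENNReal.ofReal_le_ofReal ?_
        rw [add_mul]
        gcongr
        exact le_mul_of_one_le_right (norm_nonneg _) hLp

/-- At the real point `z = a` the integrand is nonnegative, so the part `t < a` may be dropped. For
`t ≥ a` one has `1-ta ≤ 1-a²`, and `t ≥ 1/2` explains the factor 2. -/
lemma le_norm_deriv_cesaroLike_logTest (μ : Measure (Ico (0 : ℝ) 1)) [IsFiniteMeasure μ]
    (a : Ico (0 : ℝ) 1) (ha : 1 / 2 ≤ (a : ℝ)) :
    μ.real (Ici a) * Real.log (Real.exp 1 / (1 - a)) / (2 * (1 - (a : ℝ) ^ 2) ^ 2) ≤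
      ‖deriv (cesaroLike μ (logTest a a.2.1 a.2.2.le ((1 + Real.log 3 : ℝ) : ℂ))).1 (a : ℝ)‖ := by
  obtain ⟨a, h0, h1⟩ := a
  simp only at ha ⊢
  set c : ℝ := 1 + Real.log 3 with hc
  set f := logTest a h0 h1.le (c : ℂ) with hf
  set L := Real.log (Real.exp 1 / (1 - a)) with hL
  have hL1 : 1 ≤ L := one_le_log_exp_one_div h0 h1
  have hc0 : 0 ≤ c := by have := Real.log_nonneg (by norm_num : (1 : ℝ) ≤ 3); linarith
  have haz : ‖((a : ℝ) : ℂ)‖ < 1 := by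
    rw [Complex.norm_real, Real.norm_of_nonneg h0]; exact h1
  obtain ⟨hint, heq⟩ := deriv_cesaroLike_eq_integral μ f haz
  have hval : ∀ t : Ico (0 : ℝ) 1,
      deriv (cesaroKernel f.1) ((t : ℝ) * (a : ℂ)) * (t : ℝ) =
        (((a / (1 - a * (t * a))) / (1 - t * a) + (c - Real.log (1 - a * (t * a))) /
          (1 - t * a) ^ 2) * t : ℝ) := by
    intro t
    have htz := norm_mul_lt_one haz t
    have ht0 := t.2.1
    have ht1 := t.2.2
    rw [(hasDerivAt_cesaroKernel f htz).deriv, hf, deriv_logTest h0 h1.le _ htz,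
      logTest_apply h0 h1.le _ htz]
    push_cast
    rw [Complex.ofReal_log (by nlinarith [mul_nonneg h0 ht0])]
    push_cast
    rfl
  set Ψ : Ico (0 : ℝ) 1 → ℝ := fun t => (((a / (1 - a * (t * a))) / (1 - t * a) +
    (c - Real.log (1 - a * (t * a))) / (1 - t * a) ^ 2) * t : ℝ) with hΨ
  have hΨint : Integrable Ψ μ := by
    have := hint.re
    refine this.congr (Filter.Eventually.of_forall fun t => ?_)
    simp only [hval, hΨ, RCLike.re_to_complex, Complex.ofReal_re]
  have hb : 0 < 1 - a ^ 2 := by nlinarith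
  have hlow : ∀ t : Ico (0 : ℝ) 1,
      (Ici (⟨a, h0, h1⟩ : Ico (0 : ℝ) 1)).indicator (fun _ => L / (2 * (1 - a ^ 2) ^ 2)) t ≤ Ψ t := by
    intro t
    have ht0 := t.2.1
    have ht1 := t.2.2
    have hta0 : 0 ≤ (t : ℝ) * a := by positivity
    have hta1 : (t : ℝ) * a < 1 := by nlinarith
    have hata1 : a * (t * a) < 1 := by nlinarith
    have hx : 0 < 1 - (t : ℝ) * a := by linarith
    have hy : 0 < 1 - a * (t * a) := by linarith
    have hlog : Real.log (1 - a * (t * a)) ≤ 0 := Real.log_nonpos hy.le (by nlinarith)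
    have hfirst : 0 ≤ (a / (1 - a * (t * a))) / (1 - t * a) := by positivity
    by_cases ht : t ∈ Ici (⟨a, h0, h1⟩ : Ico (0 : ℝ) 1)
    · rw [indicator_of_mem ht]
      have hat : a ≤ t := ht
      -- For `t ≥ a`, `1-a²t ≤ 1-a³ ≤ 3(1-a)`; the constant `1 + log 3` in the test function
      -- compensates for this 3 and for the `e` in `L`.
      have hlow1 : L ≤ c - Real.log (1 - a * (t * a)) := by
        have h3 : 1 - a * (t * a) ≤ 3 * (1 - a) := by nlinarith [mul_nonneg h0 h0]
        have h4 := Real.log_le_log hy h3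
        rw [Real.log_mul (by norm_num) (by linarith)] at h4
        rw [hL, log_exp_one_div h1, hc]
        linarith
      have h5 : (1 - t * a) ^ 2 ≤ (1 - a ^ 2) ^ 2 := by
        refine pow_le_pow_left₀ hx.le ?_ 2
        nlinarith
      calc L / (2 * (1 - a ^ 2) ^ 2) = L / (1 - a ^ 2) ^ 2 * (1 / 2) := by field_simp
        _ ≤ (c - Real.log (1 - a * (t * a))) / (1 - t * a) ^ 2 * t := by
            have h6 : 0 ≤ c - Real.log (1 - a * (t * a)) := by linarith
            exact mul_le_mul (div_le_div₀ h6 hlow1 (by positivity) h5) (ha.trans hat)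
              (by norm_num) (by positivity)
        _ ≤ Ψ t := by
            simp only [hΨ]
            gcongr
            linarith
    · rw [indicator_of_notMem ht]
      have : 0 ≤ c - Real.log (1 - a * (t * a)) := by linarith
      simp only [hΨ]
      positivity
  have hre : (∫ t, Ψ t ∂μ) = (deriv (cesaroLike μ f).1 (a : ℂ)).re := by
    rw [heq, integral_congr_ae (Filter.Eventually.of_forall hval), integral_complex_ofReal,
      Complex.ofReal_re]
  calc _ = ∫ t, (Ici (⟨a, h0, h1⟩ : Ico (0 : ℝ) 1)).indicator
        (fun _ => L / (2 * (1 - a ^ 2) ^ 2)) t ∂μ := by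
        rw [integral_indicator_const _ measurableSet_Ici, smul_eq_mul, mul_div_assoc]
    _ ≤ ∫ t, Ψ t ∂μ := integral_mono ((integrable_const _).indicator measurableSet_Ici) hΨint hlow
    _ ≤ _ := by
        rw [hre]
        exact Complex.re_le_norm _

/-! ### The two implications -/

lemma isLogCarleson_of_isBoundedFromBesov {p q : ℝ} (hpq : p.HolderConjugate q)
    {X : Type*} [NormedAddCommGroup X] [NormedSpace ℂ X] {ι : X →ₗ[ℂ] HolDisc}
    (hX : IsAnalyticBanachSpace ι) (hXB : Set.range ι ⊆ Bloch)
    {μ : Measure (Ico (0 : ℝ) 1)} [IsFiniteMeasure μ]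
    (hT : IsBoundedFromBesov p ι (cesaroLike μ)) : IsLogCarleson (1 / q) 1 μ := by
  have hp0 : 0 < p := hpq.pos
  have hq0 : 0 < q := hpq.symm.pos
  have hpq1 : 1 / p + 1 / q = 1 := by simpa using hpq.inv_add_inv_eq_one
  obtain ⟨B, hB⟩ := hT
  obtain ⟨K, hK0, hK⟩ := exists_norm_deriv_le_of_range_subset_bloch hX hXB
  obtain ⟨C, hC0, hC⟩ := besovNorm_logTest_le hpq.lt ((1 + Real.log 3 : ℝ) : ℂ)
  set M := μ.real univ * (Real.log (Real.exp 1 / (1 - 1 / 2)) ^ (1 / q) * (1 - 1 / 2) ^ (-1 : ℝ))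
    with hM
  refine ⟨max M (4 * (K * (B * C))), ?_⟩
  rintro _ ⟨t, rfl⟩
  have ht0 := t.2.1
  have ht1 := t.2.2
  have ht : 0 < 1 - (t : ℝ) := by linarith
  set L := Real.log (Real.exp 1 / (1 - (t : ℝ))) with hL
  have hL1 : 1 ≤ L := one_le_log_exp_one_div ht0 ht1
  simp only [Real.rpow_one]
  rcases le_or_gt (t : ℝ) (1 / 2) with h | h
  -- The test functions require `t ≥ 1/2`; below that, monotonicity of the weight and finiteness of
  -- `μ` suffice.
  · refine le_trans ?_ (le_max_left _ _)
    have h2 := logWeight_mono (β := 1 / q) (γ := -1) (by positivity) (by norm_num) ht0 h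
      (by norm_num)
    rw [Real.rpow_neg_one, ← div_eq_mul_inv] at h2
    rw [mul_div_assoc, hM]
    exact mul_le_mul (measureReal_mono (subset_univ _) (measure_ne_top μ _)) h2 (by positivity)
      measureReal_nonneg
  · refine le_trans ?_ (le_max_right _ _)
    have hb : 0 < 1 - (t : ℝ) ^ 2 := by nlinarith
    have hlow := le_norm_deriv_cesaroLike_logTest μ t h.le
    have hN := hC t ht0 ht1
    set f := logTest t ht0 ht1.le ((1 + Real.log 3 : ℝ) : ℂ) with hf
    obtain ⟨x, hx, hxn⟩ := hB f (hN.trans_lt ENNReal.ofReal_lt_top)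
    have hxn' : ‖x‖ ≤ B * (C * L ^ (1 / p)) := by
      rw [← ENNReal.ofReal_le_ofReal_iff (by positivity), ofReal_norm,
        ENNReal.ofReal_mul (by positivity), ENNReal.ofReal_coe_nnreal]
      exact hxn.trans (mul_le_mul_right hN _)
    have hup := hK x (t : ℝ) (by rw [Complex.norm_real, Real.norm_of_nonneg ht0]; exact ht1)
    rw [hx, Complex.norm_real, Real.norm_of_nonneg ht0] at hup
    have h3 : (1 - (t : ℝ) ^ 2) * (μ.real (Ici t) * L / (2 * (1 - (t : ℝ) ^ 2) ^ 2)) ≤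
        K * (B * (C * L ^ (1 / p))) :=
      (mul_le_mul_of_nonneg_left hlow hb.le).trans
        (hup.trans (mul_le_mul_of_nonneg_left hxn' hK0))
    have hLp : 0 < L ^ (1 / p) := by positivity
    -- Cancelling `L^{1/p}`, the norm of the test function, leaves the exponent `1/q`.
    have hLL : L = L ^ (1 / q) * L ^ (1 / p) := by
      rw [← Real.rpow_add (by linarith), add_comm, hpq1, Real.rpow_one]
    have h4 : μ.real (Ici t) * L ^ (1 / q) / (2 * (1 - (t : ℝ) ^ 2)) ≤ K * (B * C) := by
      refine le_of_mul_le_mul_right (le_trans (le_of_eq ?_) (h3.trans (le_of_eq ?_))) hLp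
      · conv_rhs => rw [hLL]
        field_simp
      · ring
    rw [div_le_iff₀ (by positivity)] at h4
    rw [div_le_iff₀ ht]
    refine h4.trans ?_
    have h5 : 2 * (1 - (t : ℝ) ^ 2) ≤ 4 * (1 - t) := by nlinarith
    have : 0 ≤ K * (B * C) := by positivity
    nlinarith

lemma isBoundedFromBesov_of_isLogCarleson {p q s : ℝ} (hpq : p.HolderConjugate q) (hs : 1 < s)
    {X : Type*} [NormedAddCommGroup X] [NormedSpace ℂ X] {ι : X →ₗ[ℂ] HolDisc}
    (hX : IsAnalyticBanachSpace ι) (hΛX : MeanLipschitz s (1 / s) ⊆ Set.range ι)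
    {μ : Measure (Ico (0 : ℝ) 1)} [IsFiniteMeasure μ] (hμ : IsLogCarleson (1 / q) 1 μ) :
    IsBoundedFromBesov p ι (cesaroLike μ) := by
  have hs0 : 0 < s := by linarith
  -- The midpoint of `1/s` and 1: `as > 1` serves the circular means and `a < 1` the Carleson
  -- integral.
  set a := (1 + 1 / s) / 2 with ha
  have hs1 : 1 / s < 1 := by rw [div_lt_one hs0]; exact hs
  have ha0 : 0 ≤ a := by positivity
  have ha1 : a < 1 := by linarith
  have has : 1 < a * s := by
    have : a * s = (s + 1) / 2 := by rw [ha]; field_simp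
    linarith
  set W : ℂ → ℝ := fun z => ‖1 - z‖ ^ (-a) * (1 - ‖z‖) ^ (a - 1) with hW
  have hWb : ∀ r < 1, ∃ B : ℝ, ∀ z : ℂ, ‖z‖ ≤ r → W z ≤ B := by
    intro r hr
    refine ⟨(1 - r) ^ (-a) * (1 - r) ^ (a - 1), fun z hz => ?_⟩
    have hr0 : 0 < 1 - r := by linarith
    have h1 := norm_sub_norm_le (1 : ℂ) z
    rw [norm_one] at h1
    exact mul_le_mul (Real.rpow_le_rpow_of_nonpos hr0 (by linarith) (by linarith))
      (Real.rpow_le_rpow_of_nonpos hr0 (by linarith) (by linarith))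
      (Real.rpow_nonneg (by linarith) _) (by positivity)
  have hmem : ∀ K : ℝ, 0 ≤ K → ∀ g : HolDisc,
      (∀ z : ℂ, ‖z‖ < 1 → ‖deriv g.1 z‖ ≤ K * W z) → g ∈ Set.range ι :=
    fun K hK g hg => hΛX (mem_meanLipschitz_of_norm_deriv_le hs has hK hg)
  obtain ⟨C, hC0, hC⟩ := exists_norm_le_of_dominated hX hWb hmem
  obtain ⟨K, hK0, hK⟩ := norm_deriv_cesaroLike_le hpq ha0 ha1 hμ
  set M := μ.real univ with hM
  have hM0 : 0 ≤ M := measureReal_nonneg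
  refine ⟨(C * (K + M)).toNNReal, fun f hf => ?_⟩
  set N := (besovNorm p f).toReal with hN'
  have hN0 : 0 ≤ N := ENNReal.toReal_nonneg
  have hN : besovNorm p f = ENNReal.ofReal N := (ENNReal.ofReal_toReal (ne_of_lt hf)).symm
  have hf0 : ‖f.1 0‖ ≤ N := by
    rw [← ENNReal.ofReal_le_ofReal_iff hN0, ← hN, ofReal_norm, besovNorm]
    exact le_self_add
  obtain ⟨x, hx⟩ := hmem (K * N) (by positivity) (cesaroLike μ f) (hK f hf)
  refine ⟨x, hx, ?_⟩
  -- At the origin the operator multiplies by the total mass `μ_0`.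
  have hg0 : ‖(ι x).1 0‖ ≤ M * N := by
    have : (ι x).1 0 = M • f.1 0 := by
      rw [hx, cesaroLike_eq_integral μ f (by simp)]
      simp [cesaroKernel, hM]
    rw [this, norm_smul, Real.norm_of_nonneg hM0]
    gcongr
  have hWnn : ∀ z : ℂ, ‖z‖ < 1 → 0 ≤ W z := fun z hz =>
    mul_nonneg (by positivity) (Real.rpow_nonneg (by linarith) _)
  -- Rescaling into the unit ball of dominated functions; `ε` keeps the divisor positive when `f =
  -- 0`.
  have hε : ∀ ε : ℝ, 0 < ε → ‖x‖ ≤ C * ((K + M) * N + ε) := by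
    intro ε hε
    set κ := (K + M) * N + ε with hκ
    have hκ0 : 0 < κ := by positivity
    have h1 := hC (((κ⁻¹ : ℝ) : ℂ) • x) ?_ ?_
    · rw [norm_smul, Complex.norm_real, Real.norm_of_nonneg (by positivity),
        inv_mul_le_iff₀ hκ0] at h1
      linarith
    · rw [map_smul, Submodule.coe_smul, Pi.smul_apply, norm_smul, Complex.norm_real,
        Real.norm_of_nonneg (by positivity), inv_mul_le_iff₀ hκ0, hκ]
      nlinarith [mul_nonneg hK0 hN0]
    · intro z hz
      rw [map_smul, Submodule.coe_smul, deriv_const_smul _ (holDisc_differentiableAt _ hz),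
        norm_smul, Complex.norm_real, Real.norm_of_nonneg (by positivity), inv_mul_le_iff₀ hκ0, hx]
      refine (hK f hf z hz).trans (mul_le_mul_of_nonneg_right ?_ (hWnn z hz))
      rw [hκ]
      nlinarith [mul_nonneg hM0 hN0]
  have hfin : ‖x‖ ≤ C * (K + M) * N := by
    refine le_of_forall_pos_le_add fun ε hε' => ?_
    have h2 := hε (ε / (C + 1)) (by positivity)
    have h3 : C * (ε / (C + 1)) ≤ ε := by
      rw [mul_div_assoc', div_le_iff₀ (by positivity)]
      nlinarith
    linarith
  rw [hN, ← ofReal_norm, ← ENNReal.ofReal_coe_nnreal, Real.coe_toNNReal _ (by positivity),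
    ← ENNReal.ofReal_mul (by positivity)]
  exact ENNReal.ofReal_le_ofReal hfin

end

theorem theorem3p1 (p s q : ℝ) (hp : 1 < p) (hs : 1 < s) (hpq : 1 / p + 1 / q = 1)
    {X : Type*} [NormedAddCommGroup X] [NormedSpace ℂ X] (ι : X →ₗ[ℂ] HolDisc)
    (hX : IsAnalyticBanachSpace ι)
    (hΛX : MeanLipschitz s (1 / s) ⊆ Set.range ι) (hXB : Set.range ι ⊆ Bloch)
    (μ : MeasureTheory.Measure (Set.Ico (0 : ℝ) 1)) [MeasureTheory.IsFiniteMeasure μ] :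
    IsBoundedFromBesov p ι (cesaroLike μ) ↔ IsLogCarleson (1 / q) 1 μ := by
  have h : p.HolderConjugate q := Real.holderConjugate_iff.2 ⟨hp, by simpa using hpq⟩
  exact ⟨fun hT => isLogCarleson_of_isBoundedFromBesov h hX hXB hT,
    fun hμ => isBoundedFromBesov_of_isLogCarleson h hs hX hΛX hμ⟩
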